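/- Let $p$ be an odd prime and let $T$ be the regular $p$-adic rooted tree, whose vertices are the finite words over the alphabet $X=\{1,\dots,p\}$, the children of a vertex $v$ being the words $vx$ with $x\in X$. Write $\psi_1(g)=(g_1,\dots,g_p)$ for an automorphism $g\in\operatorname{Aut}(T)$ that fixes every vertex of the first level and acts on the subtree below the vertex $j$ as $g_j\in\operatorname{Aut}(T)$, after the natural identification of that subtree with $T$. Let $a\in\operatorname{Aut}(T)$ be the rooted automorphism that permutes the first letter of each word by the $p$-cycle $(1\,2\,\cdots\,p)$ and leaves the other letters unchanged. Let $r\ge 1$, let $\mathbf e_i=(e_{i,1},\dots,e_{i,p-1})\in(\mathbb Z/p\mathbb Z)^{p-1}$ for $1\le i\le r$ be linearly independent over $\mathbb Z/p\mathbb Z$, and let $b_1,\dots,b_r\in\operatorname{Aut}(T)$ be the automorphisms defined recursively by $$\psi_1(b_i)=(a^{e_{i,1}},\dots,a^{e_{i,p-1}},b_i).$$ Let $G=\langle a,b_1,\dots,b_r\rangle\le\operatorname{Aut}(T)$ be the associated multi-edge spinal group. Suppose that $G$ is torsion, and that $G$ has the congruence subgroup property: for every subgroup $K$ of finite index in $G$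 there is some $n$ such that $K$ contains the stabilizer $\operatorname{Stab}_G(n)$ of all elements of $G$ that fix every vertex of level $n$. Let $H$ be a group commensurable with $G$, that is, $G$ and $H$ have isomorphic subgroups of finite index. Then every maximal subgroup of $H$ has finite index in $H$. -/

import Mathlib

namespace SpinalGroup

/-- Vertices of the regular `p`-adic rooted tree: finite words over an alphabet with `p` letters.
The root is the empty word, and the children of `v` are the words `v ++ [x]`.
The letter `j` of the alphabet `{1, …, p}` is represented by `j - 1 : Fin p`. -/
abbrev Vertex (p : ℕ) : Type := List (Fin p)

/-- The automorphism group of the rooted tree: bijections of the vertex set that fix the root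
and map every child of a vertex `u` to a child of the image of `u`. -/
def treeAut (p : ℕ) : Subgroup (Equiv.Perm (Vertex p)) where
  carrier := {f | f [] = [] ∧ ∀ (u : Vertex p) (x : Fin p), ∃ y : Fin p, f (u ++ [x]) = f u ++ [y]}
  one_mem' := ⟨rfl, fun _ x => ⟨x, rfl⟩⟩
  mul_mem' := by
    rintro f g ⟨hf, hf'⟩ ⟨hg, hg'⟩
    refine ⟨by simp [hf, hg], fun u x => ?_⟩
    obtain ⟨y, hy⟩ := hg' u x
    obtain ⟨z, hz⟩ := hf' (g u) y
    exact ⟨z, by simp [hy, hz]⟩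
  inv_mem' := by
    rintro f ⟨hf, hf'⟩
    refine ⟨by rw [Equiv.Perm.inv_eq_iff_eq, hf], fun u x => ?_⟩
    rcases List.eq_nil_or_concat' (f⁻¹ (u ++ [x])) with h | ⟨w, z, h⟩
    · rw [Equiv.Perm.inv_eq_iff_eq, hf] at h
      simp at h
    · obtain ⟨y, hy⟩ := hf' w z
      have h2 := h
      rw [Equiv.Perm.inv_eq_iff_eq, hy] at h2
      have h3 : u = f w := (List.append_inj' h2 rfl).1
      exact ⟨z, by rw [h, h3]; simp⟩

/-- The rooted automorphism that permutes the first letter of a word by `σ`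
and leaves the remaining letters unchanged. -/
def rootedAut {p : ℕ} (σ : Equiv.Perm (Fin p)) : treeAut p where
  val :=
    { toFun := fun v => match v with
        | [] => []
        | x :: u => σ x :: u
      invFun := fun v => match v with
        | [] => []
        | x :: u => σ.symm x :: u
      left_inv := by rintro (_ | ⟨x, u⟩) <;> simp
      right_inv := by rintro (_ | ⟨x, u⟩) <;> simp }
  property := by
    refine ⟨rfl, ?_⟩
    rintro (_ | ⟨z, u⟩) x
    · exact ⟨σ x, rfl⟩
    · exact ⟨x, rfl⟩

/-- The rooted automorphism `a`, given by the `p`-cycle `(1 2 … p)` on the first level. -/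
def aut_a (p : ℕ) : treeAut p := rootedAut (finRotate p)

/-- The recursively defined map that stabilizes the first level, acts as `g j` on the subtree
below the `j`-th vertex of the first level for each of the first `p - 1` vertices, and acts as
itself on the subtree below the last vertex of the first level. -/
def directedFun {p : ℕ} (g : Fin (p - 1) → treeAut p) : Vertex p → Vertex p
  | [] => []
  | x :: u => if h : (x : ℕ) < p - 1 then x :: (g ⟨x, h⟩).1 u else x :: directedFun g u

theorem directedFun_inv {p : ℕ} (g : Fin (p - 1) → treeAut p) (v : Vertex p) :
    directedFun (fun j => (g j)⁻¹) (directedFun g v) = v := by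
  induction v with
  | nil => rfl
  | cons x u ih =>
    by_cases h : (x : ℕ) < p - 1
    · simp [directedFun, h]
    · simp [directedFun, h, ih]

/-- The automorphism `b` in the stabilizer of the first level that is determined by
`ψ₁(b) = (g₁, …, g_{p-1}, b)`. -/
def directedAut {p : ℕ} (g : Fin (p - 1) → treeAut p) : treeAut p where
  val :=
    { toFun := directedFun g
      invFun := directedFun fun j => (g j)⁻¹
      left_inv := directedFun_inv g
      right_inv := fun v => by simpa using directedFun_inv (fun j => (g j)⁻¹) v }
  property := by
    refine ⟨rfl, fun u x => ?_⟩
    change ∃ y, directedFun g (u ++ [x]) = directedFun g u ++ [y]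
    induction u with
    | nil =>
      refine ⟨x, ?_⟩
      by_cases h : (x : ℕ) < p - 1
      · simp [directedFun, h, (g ⟨x, h⟩).2.1]
      · simp [directedFun, h]
    | cons z u ih =>
      by_cases h : (z : ℕ) < p - 1
      · obtain ⟨y, hy⟩ := (g ⟨z, h⟩).2.2 u x
        exact ⟨y, by simp [directedFun, h, hy]⟩
      · obtain ⟨y, hy⟩ := ih
        exact ⟨y, by simp [directedFun, h, hy]⟩

/-- The automorphism `b` with `ψ₁(b) = (a ^ e₁, …, a ^ e_{p-1}, b)` for a vector `e` over `ℤ/pℤ`.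
Since `a ^ p = 1`, any representative of the residue class `e j` may serve as exponent. -/
def aut_b {p : ℕ} (e : Fin (p - 1) → ZMod p) : treeAut p :=
  directedAut fun j => aut_a p ^ (e j).val

/-- The group `⟨a, b₁, …, b_r⟩` associated to the tuple `E = (e₁, …, e_r)` of vectors; it is a
multi-edge spinal group if `r ≥ 1` and the vectors are linearly independent over `ℤ/pℤ`. -/
def multiEdgeSpinalGroup {p r : ℕ} (E : Fin r → Fin (p - 1) → ZMod p) : Subgroup (treeAut p) :=
  Subgroup.closure (insert (aut_a p) (Set.range fun i => aut_b (E i)))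

/-- The stabilizer in `G` of the `n`-th level of the tree. -/
def levelStabilizer {p : ℕ} (G : Subgroup (treeAut p)) (n : ℕ) : Subgroup G where
  carrier := {g | ∀ v : Vertex p, v.length = n → g.1.1 v = v}
  one_mem' := fun _ _ => rfl
  mul_mem' := by
    intro f g hf hg v hv
    simp [hg v hv, hf v hv]
  inv_mem' := by
    intro f hf v hv
    simp only [InvMemClass.coe_inv]
    rw [Equiv.Perm.inv_eq_iff_eq, hf v hv]

/-- The congruence subgroup property: every subgroup of finite index in `G` contains a level
stabilizer. -/
def HasCongruenceSubgroupProperty {p : ℕ} (G : Subgroup (treeAut p)) : Prop :=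
  ∀ K : Subgroup G, K.FiniteIndex → ∃ n : ℕ, levelStabilizer G n ≤ K

/-- Two groups are commensurable if they have isomorphic subgroups of finite index. -/
def AreCommensurable (G H : Type*) [Group G] [Group H] : Prop :=
  ∃ (A : Subgroup G) (B : Subgroup H), A.FiniteIndex ∧ B.FiniteIndex ∧ Nonempty (A ≃* B)

end SpinalGroup

namespace SpinalGroup

open scoped commutatorElement

variable {p : ℕ}

/-! ### Sections of tree automorphisms -/

/-! Write `G` for the spinal group and suppose that a maximal subgroup `M` of `H` has infinite
index. Then `M C = H` for every normal subgroup `C` of finite index, so the trace of `M` on the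
common finite-index subgroup is dense in it. It therefore suffices that a subgroup `A` of finite
index in `G` has no proper subgroup `D` that agrees with it on every level (`le_of_approximates`).
By the congruence property, such a `D` equals `A` as soon as it has finite index.

Branching. Torsion forces the entries of every exponent vector to sum to zero (`sum_expo_eq_zero`).
A nonzero vector thus has two nonzero entries and is not constant. Consequently `G''` contains a
copy of itself below every vertex (`graft_mem_derivedTwo`), and the sections of `G''` three levels
down are all of `G`. Since `G` is a finitely generated torsion group, `G''` and its derived subgroup
have finite index.

From sections to finite index. If `D` is dense in a level stabilizer and its sections at that level
are all of `G`, then `D` has finite index (`relIndex_ne_zero_of_secSub`): density and the congruence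
property yield elements of `D` that are trivial below one vertex and move vertices below another.
Commutators with grafted elements then isolate finite-index subgroups below single vertices.

Dense subgroups of `G` are `G` (`IsDense.spinal_le`). The section of a dense subgroup is dense, and
if it is `G` at a single vertex of the first level, then the subgroup is `G`. So one may pass to
sections freely. Descent on word length and order produces a letter `aut_b f`, then a conjugate of
`a`, then `a` itself, and finally all letters. Applied to the sections of `D`, this completes the
argument. -/

@[simp] theorem smul_nil (g : treeAut p) : g • ([] : Vertex p) = [] := g.2.1

theorem smul_concat (g : treeAut p) (u : Vertex p) (x : Fin p) :
    ∃ y, g • (u ++ [x]) = g • u ++ [y] := g.2.2 u x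

@[simp] theorem length_smul (g : treeAut p) (v : Vertex p) : (g • v).length = v.length := by
  induction v using List.reverseRecOn with
  | nil => simp
  | append_singleton u x ih =>
    obtain ⟨y, hy⟩ := smul_concat g u x
    simp [hy, ih]

theorem exists_smul_append (g : treeAut p) (v w : Vertex p) :
    ∃ w', g • (v ++ w) = g • v ++ w' := by
  induction w using List.reverseRecOn with
  | nil => exact ⟨[], by simp⟩
  | append_singleton u x ih =>
    obtain ⟨w', hw⟩ := ih
    obtain ⟨y, hy⟩ := smul_concat g (v ++ u) x
    exact ⟨w' ++ [y], by rw [← List.append_assoc, hy, hw, List.append_assoc]⟩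

theorem smul_append_drop (g : treeAut p) (v w : Vertex p) :
    g • (v ++ w) = g • v ++ (g • (v ++ w)).drop v.length := by
  obtain ⟨w', hw⟩ := exists_smul_append g v w
  rw [hw]
  congr 1
  rw [← length_smul g v, List.drop_left]

/-- The section of `g` at the vertex `v`: the automorphism `h` with `g (v w) = g(v) h(w)`. -/
def sec (g : treeAut p) (v : Vertex p) : treeAut p where
  val :=
    { toFun := fun w => (g • (v ++ w)).drop v.length
      invFun := fun w => (g⁻¹ • (g • v ++ w)).drop v.length
      left_inv := fun w => by
        change (g⁻¹ • (g • v ++ (g • (v ++ w)).drop v.length)).drop v.length = w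
        rw [← smul_append_drop, inv_smul_smul, List.drop_left]
      right_inv := fun w => by
        have h := smul_append_drop g⁻¹ (g • v) w
        rw [inv_smul_smul, length_smul] at h
        change (g • (v ++ (g⁻¹ • (g • v ++ w)).drop v.length)).drop v.length = w
        rw [← h, smul_inv_smul, ← length_smul g v, List.drop_left] }
  property := by
    constructor
    · change (g • (v ++ [])).drop v.length = []
      rw [List.append_nil, ← length_smul g v, List.drop_length]
    · intro u x
      obtain ⟨y, hy⟩ := smul_concat g (v ++ u) x
      refine ⟨y, ?_⟩
      change (g • (v ++ (u ++ [x]))).drop v.length = (g • (v ++ u)).drop v.length ++ [y]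
      rw [← List.append_assoc, hy, List.drop_append_of_le_length (by simp)]

theorem smul_append (g : treeAut p) (v w : Vertex p) :
    g • (v ++ w) = g • v ++ sec g v • w := smul_append_drop g v w

theorem smul_cons (g : treeAut p) (x : Fin p) (w : Vertex p) :
    g • (x :: w) = g • [x] ++ sec g [x] • w := smul_append g [x] w

theorem ext_smul {g h : treeAut p} (H : ∀ v : Vertex p, g • v = h • v) : g = h :=
  Subtype.ext (Equiv.ext H)

theorem sec_unique {g h : treeAut p} {v : Vertex p}
    (H : ∀ w, g • (v ++ w) = g • v ++ h • w) : sec g v = h :=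
  ext_smul fun w => List.append_cancel_left ((smul_append g v w).symm.trans (H w))

@[simp] theorem sec_nil (g : treeAut p) : sec g [] = g := sec_unique fun w => by simp

@[simp] theorem sec_one (v : Vertex p) : sec (1 : treeAut p) v = 1 := sec_unique fun w => by simp

theorem sec_mul (g h : treeAut p) (v : Vertex p) :
    sec (g * h) v = sec g (h • v) * sec h v :=
  sec_unique fun w => by simp only [mul_smul, smul_append]

theorem sec_append (g : treeAut p) (v w : Vertex p) : sec g (v ++ w) = sec (sec g v) w :=
  sec_unique fun u => by simp only [List.append_assoc, smul_append]

theorem sec_inv_smul (g : treeAut p) (v : Vertex p) : sec g⁻¹ (g • v) = (sec g v)⁻¹ := by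
  rw [eq_inv_iff_mul_eq_one, ← sec_mul, inv_mul_cancel, sec_one]

theorem sec_inv (g : treeAut p) (v : Vertex p) : sec g⁻¹ v = (sec g (g⁻¹ • v))⁻¹ := by
  rw [← sec_inv_smul, smul_inv_smul]

theorem sec_inv_of_fix {g : treeAut p} {v : Vertex p} (h : g • v = v) :
    sec g⁻¹ v = (sec g v)⁻¹ := by
  conv_lhs => rw [← h]
  exact sec_inv_smul g v

theorem inv_smul_of_fix {g : treeAut p} {v : Vertex p} (h : g • v = v) : g⁻¹ • v = v := by
  rw [inv_smul_eq_iff, h]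

theorem sec_pow_of_fix {g : treeAut p} {v : Vertex p} (h : g • v = v) (n : ℕ) :
    g ^ n • v = v ∧ sec (g ^ n) v = sec g v ^ n := by
  induction n with
  | zero => simp
  | succ n ih => exact ⟨by rw [pow_succ, mul_smul, h, ih.1], by rw [pow_succ, sec_mul, h, ih.2, pow_succ]⟩

theorem sec_conj {g h : treeAut p} {v : Vertex p} (hv : h • g • v = g • v) :
    (g⁻¹ * h * g) • v = v ∧ sec (g⁻¹ * h * g) v = (sec g v)⁻¹ * sec h (g • v) * sec g v := by
  constructor
  · rw [mul_smul, mul_smul, hv, inv_smul_smul]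
  · rw [sec_mul, sec_mul, hv, sec_inv_smul]

theorem sec_commutator {g h : treeAut p} {v : Vertex p} (hg : g • v = v) (hh : h • v = v) :
    sec ⁅g, h⁆ v = ⁅sec g v, sec h v⁆ := by
  have hg' := inv_smul_of_fix hg
  have hh' := inv_smul_of_fix hh
  simp only [commutatorElement_def, sec_mul, hh', hg', hh, sec_inv_of_fix hg, sec_inv_of_fix hh]

/-- The automorphism that fixes the first level and has the given first level sections. -/
def ofSections : (Fin p → treeAut p) →* treeAut p where
  toFun f :=
    ⟨{ toFun := fun v => match v with
          | [] => []
          | x :: u => x :: f x • u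
       invFun := fun v => match v with
          | [] => []
          | x :: u => x :: (f x)⁻¹ • u
       left_inv := by rintro (_ | ⟨x, u⟩) <;> simp
       right_inv := by rintro (_ | ⟨x, u⟩) <;> simp }, rfl, by
      rintro (_ | ⟨z, u⟩) x
      · exact ⟨x, by simp⟩
      · obtain ⟨y, hy⟩ := smul_concat (f z) u x
        exact ⟨y, by simp [hy]⟩⟩
  map_one' := ext_smul (by rintro (_ | ⟨x, u⟩) <;> rfl)
  map_mul' f g := ext_smul (by rintro (_ | ⟨x, u⟩) <;> rfl)

theorem ofSections_smul_cons (f : Fin p → treeAut p) (x : Fin p) (u : Vertex p) :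
    ofSections f • (x :: u) = x :: f x • u := rfl

@[simp] theorem ofSections_smul_singleton (f : Fin p → treeAut p) (x : Fin p) :
    ofSections f • [x] = [x] := by
  rw [ofSections_smul_cons, smul_nil]

@[simp] theorem sec_ofSections (f : Fin p → treeAut p) (x : Fin p) :
    sec (ofSections f) [x] = f x :=
  sec_unique fun w => by simp [ofSections_smul_cons]

theorem eq_ofSections {g : treeAut p} (h : ∀ x : Fin p, g • [x] = [x]) :
    g = ofSections fun x => sec g [x] := by
  refine ext_smul ?_
  rintro (_ | ⟨x, u⟩)
  · simp
  · rw [smul_cons, h, ofSections_smul_cons, List.singleton_append]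

/-- The automorphism that acts as `g` below the vertex `u` and trivially elsewhere. -/
def graft : Vertex p → treeAut p → treeAut p
  | [], g => g
  | x :: u, g => ofSections (Pi.mulSingle x (graft u g))

@[simp] theorem graft_nil (g : treeAut p) : graft [] g = g := rfl

theorem graft_cons (x : Fin p) (u : Vertex p) (g : treeAut p) :
    graft (x :: u) g = ofSections (Pi.mulSingle x (graft u g)) := rfl

theorem graft_fix (u v : Vertex p) (g : treeAut p) (h : v.length = u.length) :
    graft u g • v = v := by
  induction u generalizing v with
  | nil => rw [List.length_eq_zero_iff.1 h, smul_nil]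
  | cons x u ih =>
    match v, h with
    | y :: v, h =>
      rw [graft_cons, ofSections_smul_cons]
      rcases eq_or_ne y x with rfl | hy
      · rw [Pi.mulSingle_eq_same, ih v (by simpa using h)]
      · rw [Pi.mulSingle_eq_of_ne hy, one_smul]

theorem sec_cons (g : treeAut p) (x : Fin p) (u : Vertex p) : sec g (x :: u) = sec (sec g [x]) u :=
  sec_append g [x] u

@[simp] theorem sec_graft_self (u : Vertex p) (g : treeAut p) : sec (graft u g) u = g := by
  induction u with
  | nil => simp
  | cons x u ih => rw [sec_cons, graft_cons, sec_ofSections, Pi.mulSingle_eq_same, ih]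

theorem sec_graft_of_ne {u v : Vertex p} (g : treeAut p) (h : v.length = u.length) (hv : v ≠ u) :
    sec (graft u g) v = 1 := by
  induction u generalizing v with
  | nil => exact absurd (List.length_eq_zero_iff.1 h) hv
  | cons x u ih =>
    match v, h, hv with
    | y :: v, h, hv =>
      rw [sec_cons, graft_cons, sec_ofSections]
      rcases eq_or_ne y x with rfl | hy
      · rw [Pi.mulSingle_eq_same, ih (by simpa using h) (by simpa using hv)]
      · rw [Pi.mulSingle_eq_of_ne hy, sec_one]

theorem ext_level (n : ℕ) {g h : treeAut p} (h₁ : ∀ v : Vertex p, v.length = n → g • v = h • v)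
    (h₂ : ∀ v : Vertex p, v.length = n → sec g v = sec h v) : g = h := by
  have key : ∀ v : Vertex p, n ≤ v.length → g • v = h • v := fun v hv => by
    have hl : (v.take n).length = n := by simpa using hv
    rw [← List.take_append_drop n v, smul_append, smul_append, h₁ _ hl, h₂ _ hl]
  refine ext_smul fun v => ?_
  rcases le_or_gt n v.length with hv | hv
  · exact key v hv
  · rcases v with _ | ⟨x, u⟩
    · simp
    -- A word above level `n` is padded with its own first letter to reach that level.
    · have := key ((x :: u) ++ List.replicate n x) (by simp; omega)
      rw [smul_append, smul_append] at this
      exact (List.append_inj this (by simp)).1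

theorem smul_eq_of_le {g h : treeAut p} {m n : ℕ} (hmn : m ≤ n) (hp : 0 < p)
    (H : ∀ v : Vertex p, v.length = n → g • v = h • v) (v : Vertex p) (hv : v.length = m) :
    g • v = h • v := by
  have := H (v ++ List.replicate (n - m) ⟨0, hp⟩) (by simp; omega)
  rw [smul_append, smul_append] at this
  exact (List.append_inj this (by simp)).1

theorem sec_smul_eq_of_smul_eq {g h : treeAut p} {n : ℕ} {v : Vertex p}
    (H : ∀ w : Vertex p, w.length = v.length + n → g • w = h • w) (w : Vertex p)
    (hw : w.length = n) : sec g v • w = sec h v • w := by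
  have := H (v ++ w) (by simp [hw])
  rw [smul_append, smul_append] at this
  exact (List.append_inj this (by simp)).2

/-! ### The generators -/

section Prime

variable [hpr : Fact p.Prime]

instance neZero_of_prime : NeZero p := ⟨hpr.out.ne_zero⟩

/-- The last letter of the alphabet. -/
def lastLetter (p : ℕ) [Fact p.Prime] : Fin p :=
  ⟨p - 1, Nat.sub_lt (Fact.out : p.Prime).pos one_pos⟩

theorem aut_a_smul_cons (x : Fin p) (u : Vertex p) : aut_a p • (x :: u) = (x + 1) :: u := by
  change finRotate p x :: u = _
  rw [finRotate_apply]

theorem aut_a_pow_smul_cons (n : ℕ) (x : Fin p) (u : Vertex p) :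
    aut_a p ^ n • (x :: u) = (x + n • 1) :: u := by
  induction n with
  | zero => simp
  | succ n ih => rw [pow_succ', mul_smul, ih, aut_a_smul_cons, succ_nsmul, add_assoc]

theorem sec_aut_a_pow (n : ℕ) (x : Fin p) : sec (aut_a p ^ n) [x] = 1 :=
  sec_unique fun w => by simp [aut_a_pow_smul_cons]

theorem coe_nsmul_one (n : ℕ) : ((n • (1 : Fin p) : Fin p) : ℕ) = n % p := by
  induction n with
  | zero => simp
  | succ n ih => rw [succ_nsmul, Fin.val_add, ih, Fin.coe_ofNat_eq_mod, ← Nat.add_mod]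

theorem val_nsmul_one (s : Fin p) : (s : ℕ) • (1 : Fin p) = s :=
  Fin.ext (by rw [coe_nsmul_one, Nat.mod_eq_of_lt s.2])

theorem prime_nsmul_one : p • (1 : Fin p) = 0 := Fin.ext (by simp [coe_nsmul_one])

theorem nsmul_one_eq_zero_iff (n : ℕ) : n • (1 : Fin p) = 0 ↔ p ∣ n := by
  rw [Fin.ext_iff, coe_nsmul_one, Nat.dvd_iff_mod_eq_zero, Fin.val_zero]

theorem aut_a_pow_eq_one_iff (n : ℕ) : aut_a p ^ n = 1 ↔ n • (1 : Fin p) = 0 := by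
  constructor
  · intro h
    have := aut_a_pow_smul_cons n (0 : Fin p) []
    simpa [h] using this.symm
  · intro h
    refine ext_smul ?_
    rintro (_ | ⟨x, u⟩)
    · simp
    · rw [aut_a_pow_smul_cons, h, add_zero, one_smul]

theorem aut_a_pow_prime : aut_a p ^ p = 1 := (aut_a_pow_eq_one_iff p).2 prime_nsmul_one

theorem aut_a_pow_val_add (s t : ZMod p) :
    aut_a p ^ (s + t).val = aut_a p ^ s.val * aut_a p ^ t.val := by
  rw [ZMod.val_add, ← pow_add, ← pow_eq_pow_mod _ aut_a_pow_prime]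

theorem exists_aut_a_pow_smul (x y : Fin p) : ∃ n : ℕ, aut_a p ^ n • [x] = [y] :=
  ⟨(y - x : Fin p), by rw [aut_a_pow_smul_cons, val_nsmul_one, add_sub_cancel]⟩

/-- Every nontrivial power of `a` generates `⟨a⟩`. -/
theorem exists_aut_a_pow_pow {s : ZMod p} (hs : s ≠ 0) : ∃ t : ℕ, (aut_a p ^ s.val) ^ t = aut_a p := by
  refine ⟨(s⁻¹).val, ?_⟩
  rw [← pow_mul, pow_eq_pow_mod _ aut_a_pow_prime, ← ZMod.val_mul, mul_inv_cancel₀ hs,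
    ZMod.val_one, pow_one]

/-- The exponent of `a` in the section of `aut_b e` at the letter `x`. -/
def expo (e : Fin (p - 1) → ZMod p) (x : Fin p) : ZMod p :=
  -- The value 0 at the last letter makes the sum over all `p` letters the sum of the entries of
  -- `e`.
  if h : (x : ℕ) < p - 1 then e ⟨x, h⟩ else 0

theorem expo_add (e f : Fin (p - 1) → ZMod p) (x : Fin p) :
    expo (e + f) x = expo e x + expo f x := by
  unfold expo; split_ifs <;> simp

theorem expo_last (e : Fin (p - 1) → ZMod p) : expo e (lastLetter p) = 0 := by
  simp [expo, lastLetter]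

theorem lt_of_ne_last {x : Fin p} (h : x ≠ lastLetter p) : (x : ℕ) < p - 1 := by
  have := x.2
  have h' : (x : ℕ) ≠ p - 1 := fun h' => h (Fin.ext h')
  omega

theorem exists_expo_ne_zero {e : Fin (p - 1) → ZMod p} (he : e ≠ 0) :
    ∃ x, x ≠ lastLetter p ∧ expo e x ≠ 0 := by
  obtain ⟨j, hj⟩ := Function.ne_iff.1 he
  have hj' := j.2
  refine ⟨⟨j, by omega⟩, fun h => ?_, by simpa [expo] using hj⟩
  have := congrArg Fin.val h
  simp only [lastLetter] at this
  omega

theorem aut_b_smul_cons_of_ne (e : Fin (p - 1) → ZMod p) {x : Fin p} (hx : x ≠ lastLetter p)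
    (u : Vertex p) : aut_b e • (x :: u) = x :: (aut_a p ^ (expo e x).val) • u := by
  have h := lt_of_ne_last hx
  change directedFun _ (x :: u) = _
  simp only [directedFun, h, expo, dif_pos]
  rfl

theorem aut_b_smul_cons_last (e : Fin (p - 1) → ZMod p) (u : Vertex p) :
    aut_b e • (lastLetter p :: u) = lastLetter p :: aut_b e • u := by
  change directedFun _ (lastLetter p :: u) = _
  have h : ¬ ((lastLetter p : Fin p) : ℕ) < p - 1 := lt_irrefl (p - 1)
  rw [directedFun, dif_neg h]
  rfl

@[simp] theorem aut_b_smul_singleton (e : Fin (p - 1) → ZMod p) (x : Fin p) :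
    aut_b e • [x] = [x] := by
  rcases eq_or_ne x (lastLetter p) with rfl | hx
  · rw [aut_b_smul_cons_last, smul_nil]
  · rw [aut_b_smul_cons_of_ne e hx, smul_nil]

@[simp] theorem sec_aut_b_last (e : Fin (p - 1) → ZMod p) :
    sec (aut_b e) [lastLetter p] = aut_b e :=
  sec_unique fun w => by simp [aut_b_smul_cons_last]

theorem sec_aut_b_of_ne (e : Fin (p - 1) → ZMod p) {x : Fin p} (hx : x ≠ lastLetter p) :
    sec (aut_b e) [x] = aut_a p ^ (expo e x).val :=
  sec_unique fun w => by simp [aut_b_smul_cons_of_ne e hx]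

theorem aut_b_add (e f : Fin (p - 1) → ZMod p) : aut_b (e + f) = aut_b e * aut_b f := by
  refine ext_smul fun v => ?_
  induction v with
  | nil => simp
  | cons x u ih =>
    rcases eq_or_ne x (lastLetter p) with rfl | hx
    · rw [mul_smul, aut_b_smul_cons_last, aut_b_smul_cons_last, aut_b_smul_cons_last, ih, mul_smul]
    · rw [mul_smul, aut_b_smul_cons_of_ne _ hx, aut_b_smul_cons_of_ne _ hx,
        aut_b_smul_cons_of_ne _ hx, expo_add, aut_a_pow_val_add, mul_smul]

theorem aut_b_zero : aut_b (0 : Fin (p - 1) → ZMod p) = 1 := by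
  have := aut_b_add (0 : Fin (p - 1) → ZMod p) 0
  rwa [add_zero, left_eq_mul] at this

theorem aut_b_neg (e : Fin (p - 1) → ZMod p) : aut_b (-e) = (aut_b e)⁻¹ := by
  rw [eq_inv_iff_mul_eq_one, ← aut_b_add, neg_add_cancel, aut_b_zero]

theorem aut_b_comm (e f : Fin (p - 1) → ZMod p) : aut_b e * aut_b f = aut_b f * aut_b e := by
  rw [← aut_b_add, add_comm, aut_b_add]

variable (W : AddSubgroup (Fin (p - 1) → ZMod p))

/-- The group generated by `a` and all `aut_b e` with `e` in a group `W` of exponent vectors. -/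
def spinal : Subgroup (treeAut p) := Subgroup.closure (insert (aut_a p) (aut_b '' W))

/-- Since `aut_b` turns sums into products, a whole group of exponent vectors may serve as alphabet.
Adjacent letters then merge into one letter, which is what makes word length drop under sections. -/
theorem multiEdgeSpinalGroup_eq {r : ℕ} (E : Fin r → Fin (p - 1) → ZMod p) :
    multiEdgeSpinalGroup E = spinal (AddSubgroup.closure (Set.range E)) := by
  apply le_antisymm
  · refine Subgroup.closure_mono (Set.insert_subset_insert ?_)
    rintro _ ⟨i, rfl⟩
    exact ⟨E i, AddSubgroup.subset_closure ⟨i, rfl⟩, rfl⟩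
  · refine (Subgroup.closure_le _).2 (Set.insert_subset (Subgroup.subset_closure (.inl rfl)) ?_)
    rintro _ ⟨e, he, rfl⟩
    simp only [SetLike.mem_coe] at he ⊢
    induction he using AddSubgroup.closure_induction with
    | mem x hx =>
      obtain ⟨i, rfl⟩ := hx
      exact Subgroup.subset_closure (.inr ⟨i, rfl⟩)
    | zero => rw [aut_b_zero]; exact one_mem _
    | add x y _ _ hx hy => rw [aut_b_add]; exact mul_mem hx hy
    | neg x _ hx => rw [aut_b_neg]; exact inv_mem hx

variable {W}

theorem aut_a_mem : aut_a p ∈ spinal W := Subgroup.subset_closure (.inl rfl)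

theorem aut_b_mem {e : Fin (p - 1) → ZMod p} (he : e ∈ W) : aut_b e ∈ spinal W :=
  Subgroup.subset_closure (.inr ⟨e, he, rfl⟩)

/-! ### Words -/

variable (W) in
/-- `Len W n f g`: the element `g` is represented by a word with `n` letters `aut_b e`, `e ∈ W`,
whose exponent vectors add up to `f`. -/
inductive Len : ℕ → (Fin (p - 1) → ZMod p) → treeAut p → Prop
  | pow (s : ℕ) : Len 0 0 (aut_a p ^ s)
  | step {n : ℕ} {f : Fin (p - 1) → ZMod p} {g : treeAut p} (e : Fin (p - 1) → ZMod p) (s : ℕ) :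
      Len n f g → e ∈ W → Len (n + 1) (f + e) (g * aut_b e * aut_a p ^ s)

theorem Len.one : Len W 0 0 1 := by simpa using Len.pow (W := W) 0

theorem Len.mul_pow {n : ℕ} {f : Fin (p - 1) → ZMod p} {g : treeAut p} (h : Len W n f g) (s : ℕ) :
    Len W n f (g * aut_a p ^ s) := by
  cases h with
  | pow t => rw [← pow_add]; exact .pow _
  | step e t h he => rw [mul_assoc, ← pow_add]; exact .step e _ h he

theorem Len.mul_b {n : ℕ} {f e : Fin (p - 1) → ZMod p} {g : treeAut p} (h : Len W n f g)
    (he : e ∈ W) : Len W (n + 1) (f + e) (g * aut_b e) := by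
  simpa using Len.step e 0 h he

theorem Len.letter {e : Fin (p - 1) → ZMod p} (he : e ∈ W) : Len W 1 e (aut_b e) := by
  simpa using Len.one.mul_b he

theorem Len.mul {n m : ℕ} {f f' : Fin (p - 1) → ZMod p} {g h : treeAut p} (hg : Len W n f g)
    (hh : Len W m f' h) : Len W (n + m) (f + f') (g * h) := by
  induction hh with
  | pow s => simpa using hg.mul_pow s
  | step e s _ he ih =>
    rw [← mul_assoc, ← mul_assoc, ← add_assoc, ← add_assoc]
    exact .step e s ih he

theorem Len.pow_inv (s : ℕ) : Len W 0 0 (aut_a p ^ s)⁻¹ := by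
  have : (aut_a p ^ s)⁻¹ = aut_a p ^ (p * s - s) := by
    rw [inv_eq_iff_mul_eq_one, ← pow_add,
      Nat.add_sub_cancel' (Nat.le_mul_of_pos_left s hpr.out.pos), pow_mul, aut_a_pow_prime, one_pow]
  rw [this]
  exact .pow _

theorem Len.inv {n : ℕ} {f : Fin (p - 1) → ZMod p} {g : treeAut p} (hg : Len W n f g) :
    Len W n (-f) g⁻¹ := by
  induction hg with
  | pow s => simpa using Len.pow_inv s
  | step e s _ he ih =>
    have := ((Len.pow_inv s).mul (Len.letter (neg_mem he))).mul ih
    rw [aut_b_neg] at this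
    convert this using 1
    · omega
    · rw [zero_add, neg_add_rev]
    · group

theorem Len.exists_of_mem {g : treeAut p} (hg : g ∈ spinal W) : ∃ n f, Len W n f g := by
  induction hg using Subgroup.closure_induction with
  | mem x hx =>
    rcases hx with rfl | ⟨e, he, rfl⟩
    · exact ⟨0, 0, by simpa using Len.pow (W := W) 1⟩
    · exact ⟨1, e, .letter he⟩
  | one => exact ⟨0, 0, .one⟩
  | mul x y _ _ hx hy =>
    obtain ⟨n, f, hx⟩ := hx
    obtain ⟨m, f', hy⟩ := hy
    exact ⟨_, _, hx.mul hy⟩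
  | inv x _ hx =>
    obtain ⟨n, f, hx⟩ := hx
    exact ⟨_, _, hx.inv⟩

theorem Len.mem {n : ℕ} {f : Fin (p - 1) → ZMod p} {g : treeAut p} (h : Len W n f g) :
    g ∈ spinal W ∧ f ∈ W := by
  induction h with
  | pow s => exact ⟨pow_mem aut_a_mem s, zero_mem _⟩
  | step e s _ he ih =>
    exact ⟨mul_mem (mul_mem ih.1 (aut_b_mem he)) (pow_mem aut_a_mem s), add_mem ih.2 he⟩

/-- The sections of a word at the first level share out its letters; if one of them receives all
letters, then the word reduces to a single letter. -/
theorem Len.sections {n : ℕ} {f : Fin (p - 1) → ZMod p} {g : treeAut p} (h : Len W n f g) :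
    ∃ (ℓ : Fin p → ℕ) (φ : Fin p → Fin (p - 1) → ZMod p),
      (∀ x, Len W (ℓ x) (φ x) (sec g [x])) ∧ ∑ x, ℓ x = n ∧ ∑ x, φ x = f ∧
      ∀ x, ℓ x = n → ∃ s t : ℕ, g = aut_a p ^ s * aut_b f * aut_a p ^ t ∧
        aut_a p ^ t • [x] = [lastLetter p] := by
  induction h with
  | pow s =>
    refine ⟨0, 0, fun x => ?_, by simp, by simp, fun x _ => ?_⟩
    · rw [sec_aut_a_pow]; exact .one
    · obtain ⟨t, ht⟩ := exists_aut_a_pow_smul x (lastLetter p)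
      -- Without letters every `x` receives all of them: `a ^ s` is split around the trivial letter
      -- so that the right factor carries `x` to the last letter. The exponent `p * t - t` stands
      -- for `-t`.
      refine ⟨s + (p * t - t), t, ?_, ht⟩
      rw [aut_b_zero, mul_one, ← pow_add, add_assoc,
        Nat.sub_add_cancel (Nat.le_mul_of_pos_left t hpr.out.pos), pow_add, pow_mul,
        aut_a_pow_prime, one_pow, mul_one]
  | @step n f g e s _ he ih =>
    obtain ⟨ℓ, φ, h1, h2, h3, h4⟩ := ih
    let σ : Fin p ≃ Fin p := Equiv.addRight (s • (1 : Fin p))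
    have hσ (x : Fin p) : aut_a p ^ s • [x] = [σ x] := aut_a_pow_smul_cons s x []
    have hsec (x : Fin p) : sec (g * aut_b e * aut_a p ^ s) [x] =
        sec g [σ x] * sec (aut_b e) [σ x] := by
      rw [sec_mul, sec_aut_a_pow, mul_one, hσ, sec_mul, aut_b_smul_singleton]
    refine ⟨fun x => ℓ (σ x) + if σ x = lastLetter p then 1 else 0,
      fun x => φ (σ x) + if σ x = lastLetter p then e else 0, fun x => ?_, ?_, ?_, fun x hx => ?_⟩
    · rw [hsec]
      simp only
      split_ifs with hx
      · rw [hx, sec_aut_b_last]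
        exact (h1 _).mul_b he
      · rw [sec_aut_b_of_ne _ hx]
        simpa using (h1 _).mul_pow _
    · rw [σ.sum_comp fun y => ℓ y + if y = lastLetter p then 1 else 0]
      simp [Finset.sum_add_distrib, h2]
    · rw [σ.sum_comp fun y => φ y + if y = lastLetter p then e else 0]
      simp [Finset.sum_add_distrib, h3]
    · have hle : ℓ (σ x) ≤ n := h2 ▸ Finset.single_le_sum (fun _ _ => Nat.zero_le _) (Finset.mem_univ _)
      simp only at hx
      split_ifs at hx with hx'
      -- The new letter goes to the vertex that already held all the others. Then `a ^ j` fixes the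
      -- last letter, hence is trivial, and the old and new letters merge.
      · obtain ⟨i, j, hg, hj⟩ := h4 (σ x) (by omega)
        have hj1 : aut_a p ^ j = 1 := by
          rw [hx', aut_a_pow_smul_cons] at hj
          rw [aut_a_pow_eq_one_iff]
          simpa using hj
        refine ⟨i, s, ?_, by rw [hσ, hx']⟩
        rw [hg, hj1, mul_one, aut_b_add]
        group
      · omega

/-! ### The action on the first level -/

/-- `Rot g s`: the automorphism `g` acts on the first level as the rotation by `s`. -/
def Rot (g : treeAut p) (s : Fin p) : Prop := ∀ x : Fin p, g • [x] = [x + s]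

theorem Rot.mul {g h : treeAut p} {s t : Fin p} (hg : Rot g s) (hh : Rot h t) :
    Rot (g * h) (s + t) := fun x => by
  rw [mul_smul, hh x, hg, add_assoc, add_comm t]

theorem Rot.one : Rot (1 : treeAut p) 0 := fun x => by simp

theorem rot_aut_b (e : Fin (p - 1) → ZMod p) : Rot (aut_b e) 0 := fun x => by simp

theorem rot_aut_a_pow (n : ℕ) : Rot (aut_a p ^ n) (n • 1) := fun x => aut_a_pow_smul_cons n x []

theorem Rot.eq {g : treeAut p} {s t : Fin p} (h : Rot g s) (h' : Rot g t) : s = t := by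
  have := (h 0).symm.trans (h' 0)
  simpa using this

theorem Rot.pow {g : treeAut p} {s : Fin p} (h : Rot g s) (n : ℕ) : Rot (g ^ n) (n • s) := by
  induction n with
  | zero => simpa using Rot.one
  | succ n ih => rw [pow_succ, succ_nsmul]; exact ih.mul h

theorem Len.exists_rot {n : ℕ} {f : Fin (p - 1) → ZMod p} {g : treeAut p} (h : Len W n f g) :
    ∃ s, Rot g s := by
  induction h with
  | pow s => exact ⟨_, rot_aut_a_pow s⟩
  | step e s _ _ ih =>
    obtain ⟨t, ht⟩ := ih
    exact ⟨_, (ht.mul (rot_aut_b e)).mul (rot_aut_a_pow s)⟩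

theorem exists_rot {g : treeAut p} (h : g ∈ spinal W) : ∃ s, Rot g s := by
  obtain ⟨n, f, h⟩ := Len.exists_of_mem h
  exact h.exists_rot

/-- A nonzero `s` generates the cyclic group of prime order, so `x, x + s, …` meets each letter
once. -/
theorem sum_range_add_nsmul {M : Type*} [AddCommMonoid M] (F : Fin p → M) (x : Fin p) {s : Fin p}
    (hs : s ≠ 0) : ∑ i ∈ Finset.range p, F (x + i • s) = ∑ y, F y := by
  rw [Finset.sum_range fun i => F (x + i • s)]
  refine Function.Bijective.sum_comp (e := fun i : Fin p => x + (i : ℕ) • s) ?_ F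
  refine Finite.injective_iff_bijective.1 fun i j hij => ?_
  have hij' : (i : ℕ) • s = (j : ℕ) • s := add_left_cancel hij
  have ho : addOrderOf s = p := addOrderOf_eq_prime
    (by rw [← val_nsmul_one s, smul_comm, prime_nsmul_one, smul_zero]) hs
  have := nsmul_inj_mod.1 hij'
  rw [ho, Nat.mod_eq_of_lt i.2, Nat.mod_eq_of_lt j.2] at this
  exact Fin.ext this

theorem sec_pow_rot {g : treeAut p} {s : Fin p} (hg : Rot g s) {ℓ : Fin p → ℕ}
    {φ : Fin p → Fin (p - 1) → ZMod p} {ρ : Fin p → Fin p}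
    (hl : ∀ x, Len W (ℓ x) (φ x) (sec g [x])) (hr : ∀ x, Rot (sec g [x]) (ρ x)) (x : Fin p) (k : ℕ) :
    Len W (∑ i ∈ Finset.range k, ℓ (x + i • s)) (∑ i ∈ Finset.range k, φ (x + i • s))
      (sec (g ^ k) [x]) ∧ Rot (sec (g ^ k) [x]) (∑ i ∈ Finset.range k, ρ (x + i • s)) := by
  induction k with
  | zero => simpa using ⟨Len.one, Rot.one⟩
  | succ k ih =>
    rw [pow_succ', sec_mul, hg.pow k x, Finset.sum_range_succ, Finset.sum_range_succ,
      Finset.sum_range_succ, add_comm (∑ i ∈ _, ℓ _), add_comm (∑ i ∈ _, φ _),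
      add_comm (∑ i ∈ _, ρ _)]
    exact ⟨(hl _).mul ih.1, (hr _).mul ih.2⟩

/-- The sections of the `p`-th power of an element that acts nontrivially on the first level. -/
theorem Len.sec_pow_prime {n : ℕ} {f : Fin (p - 1) → ZMod p} {g : treeAut p} (h : Len W n f g)
    {s : Fin p} (hg : Rot g s) (hs : s ≠ 0) {ρ : Fin p → Fin p}
    (hr : ∀ x, Rot (sec g [x]) (ρ x)) (x : Fin p) :
    Len W n f (sec (g ^ p) [x]) ∧ Rot (sec (g ^ p) [x]) (∑ y, ρ y) := by
  obtain ⟨ℓ, φ, h1, h2, h3, -⟩ := h.sections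
  have := sec_pow_rot hg h1 hr x p
  rwa [sum_range_add_nsmul _ _ hs, sum_range_add_nsmul _ _ hs, sum_range_add_nsmul _ _ hs, h2, h3]
    at this

theorem fix_pow_prime {g : treeAut p} {s : Fin p} (hg : Rot g s) (x : Fin p) : g ^ p • [x] = [x] := by
  rw [hg.pow p x, ← val_nsmul_one s, smul_comm, prime_nsmul_one, smul_zero, add_zero]

/-- Passing from `g` to a section of `g ^ p` divides the order by `p`. -/
theorem orderOf_sec_pow_lt {g : treeAut p} (hfin : IsOfFinOrder g) {s : Fin p} (hg : Rot g s)
    (hs : s ≠ 0) (x : Fin p) :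
    IsOfFinOrder (sec (g ^ p) [x]) ∧ orderOf (sec (g ^ p) [x]) < orderOf g := by
  have hpos := hfin.orderOf_pos
  have hdvd : p ∣ orderOf g := by
    have h1 := hg.pow (orderOf g)
    rw [pow_orderOf_eq_one] at h1
    have h2 := h1.eq Rot.one
    have ho : addOrderOf s = p := addOrderOf_eq_prime
      (by rw [← val_nsmul_one s, smul_comm, prime_nsmul_one, smul_zero]) hs
    have h3 := addOrderOf_dvd_of_nsmul_eq_zero h2
    rwa [ho] at h3
  obtain ⟨k, hk⟩ := hdvd
  have hk0 : 0 < k := Nat.pos_of_ne_zero (by rintro rfl; omega)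
  have h1 : sec (g ^ p) [x] ^ k = 1 := by
    rw [← (sec_pow_of_fix (fix_pow_prime hg x) k).2, ← pow_mul, ← hk, pow_orderOf_eq_one, sec_one]
  refine ⟨isOfFinOrder_iff_pow_eq_one.2 ⟨k, hk0, h1⟩, ?_⟩
  calc orderOf (sec (g ^ p) [x]) ≤ k := orderOf_le_of_pow_eq_one hk0 h1
    _ < orderOf g := by rw [hk]; exact lt_mul_of_one_lt_left hk0 hpr.out.one_lt

end Prime

/-! ### Finite index -/

section Index

variable {Γ Δ : Type*} [Group Γ] [Group Δ]

theorem relIndex_map_ne_zero (f : Γ →* Δ) {H K : Subgroup Γ} (h : H.relIndex K ≠ 0) :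
    (H.map f).relIndex (K.map f) ≠ 0 := by
  have h1 : ((H.subgroupOf K).map (f.subgroupMap K)).index ≠ 0 :=
    ne_zero_of_dvd_ne_zero h (Subgroup.index_map_dvd _ (f.subgroupMap_surjective K))
  refine ne_zero_of_dvd_ne_zero h1 (Subgroup.index_dvd_of_le ?_)
  rintro _ ⟨x, hx, rfl⟩
  exact ⟨x, hx, rfl⟩

theorem relIndex_ne_zero_of_le {H K L : Subgroup Γ} (hHK : H ≤ K) (h : H.relIndex L ≠ 0) :
    K.relIndex L ≠ 0 := fun h' => h (Subgroup.relIndex_eq_zero_of_le_left hHK h')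

/-- In a finitely generated torsion group, the derived subgroup of a subgroup of finite index has
finite index. -/
theorem relIndex_commutator_ne_zero {G F : Subgroup Γ} (hG : G.FG)
    (htors : ∀ g ∈ G, IsOfFinOrder g) (hF : F ≤ G) (hFG : F.relIndex G ≠ 0) :
    (⁅F, F⁆ : Subgroup Γ).relIndex G ≠ 0 := by
  have : Group.FG G := (Group.fg_iff_subgroup_fg G).2 hG
  have : (F.subgroupOf G).FiniteIndex := ⟨hFG⟩
  have : Group.FG (F.subgroupOf G) := Subgroup.fg_of_index_ne_zero _
  have : Group.FG F := Group.fg_of_surjective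
    (f := (Subgroup.subgroupOfEquivOfLe hF).toMonoidHom) (Subgroup.subgroupOfEquivOfLe hF).surjective
  have : Group.FG (Abelianization F) := Group.fg_of_surjective (f := Abelianization.of)
    (QuotientGroup.mk'_surjective _)
  have : Finite (Abelianization F) := CommGroup.finite_of_fg_isMulTorsion _ fun x => by
    obtain ⟨y, rfl⟩ := QuotientGroup.mk'_surjective _ x
    exact MonoidHom.isOfFinOrder _ ((Submonoid.isOfFinOrder_coe (x := y)).1 (htors y (hF y.2)))
  have h1 : (commutator F).index ≠ 0 := by
    have : Finite (F ⧸ commutator F) := this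
    exact Subgroup.index_ne_zero_of_finite
  have h2 : (⁅F, F⁆ : Subgroup Γ).relIndex F ≠ 0 := by
    rwa [← Subgroup.map_subtype_commutator, Subgroup.relIndex, Subgroup.subgroupOf,
      Subgroup.comap_map_eq_self_of_injective F.subtype_injective]
  exact Subgroup.relIndex_ne_zero_trans h2 hFG

end Index

/-! ### Level stabilizers and groups of sections -/

variable (p) in
/-- The stabilizer of the `n`-th level. -/
def levelFix (n : ℕ) : Subgroup (treeAut p) where
  carrier := {g | ∀ v : Vertex p, v.length = n → g • v = v}
  one_mem' := fun v _ => one_smul _ v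
  mul_mem' := fun {f g} hf hg v hv => by rw [mul_smul, hg v hv, hf v hv]
  inv_mem' := fun {f} hf v hv => inv_smul_of_fix (hf v hv)

theorem index_stabilizer_ne_zero (v : Vertex p) :
    (MulAction.stabilizer (treeAut p) v).index ≠ 0 := by
  rw [MulAction.index_stabilizer]
  have hfin : (MulAction.orbit (treeAut p) v).Finite := by
    refine (List.finite_length_eq (Fin p) v.length).subset ?_
    rintro _ ⟨g, rfl⟩
    exact length_smul g v
  exact (Set.ncard_pos hfin).2 ⟨v, MulAction.mem_orbit_self v⟩ |>.ne'

theorem relIndex_stabilizer_ne_zero (v : Vertex p) (G : Subgroup (treeAut p)) :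
    (MulAction.stabilizer (treeAut p) v).relIndex G ≠ 0 := by
  have : (MulAction.stabilizer (treeAut p) v).FiniteIndex := ⟨index_stabilizer_ne_zero v⟩
  exact (Subgroup.isFiniteRelIndex_of_finiteIndex (K := G)).relIndex_ne_zero

theorem relIndex_levelFix_ne_zero (n : ℕ) (G : Subgroup (treeAut p)) :
    (levelFix p n).relIndex G ≠ 0 := by
  have : Finite {v : Vertex p // v.length = n} := (List.finite_length_eq (Fin p) n).to_subtype
  refine relIndex_ne_zero_of_le (H := ⨅ v : {v : Vertex p // v.length = n},
    MulAction.stabilizer (treeAut p) v.1) (fun g hg v hv => ?_)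
    (Subgroup.relIndex_iInf_ne_zero fun v => relIndex_stabilizer_ne_zero _ _)
  exact (Subgroup.mem_iInf.1 hg) ⟨v, hv⟩

/-- The section at a vertex, as a homomorphism on the stabilizer of this vertex. -/
def secHom (v : Vertex p) : MulAction.stabilizer (treeAut p) v →* treeAut p where
  toFun g := sec g.1 v
  map_one' := sec_one v
  map_mul' g h := by
    have h2 : h.1 • v = v := h.2
    change sec (g.1 * h.1) v = _
    rw [sec_mul, h2]

/-- The group of the sections at `v` of the elements of `M` that fix `v`. -/
def secSub (M : Subgroup (treeAut p)) (v : Vertex p) : Subgroup (treeAut p) :=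
  (M.subgroupOf (MulAction.stabilizer (treeAut p) v)).map (secHom v)

theorem mem_secSub {M : Subgroup (treeAut p)} {v : Vertex p} {h : treeAut p} :
    h ∈ secSub M v ↔ ∃ g ∈ M, g • v = v ∧ sec g v = h := by
  constructor
  · rintro ⟨g, hg, rfl⟩
    exact ⟨g.1, hg, g.2, rfl⟩
  · rintro ⟨g, hg, hv, rfl⟩
    exact ⟨⟨g, hv⟩, hg, rfl⟩

theorem sec_mem_secSub {M : Subgroup (treeAut p)} {v : Vertex p} {g : treeAut p} (hg : g ∈ M)
    (hv : g • v = v) : sec g v ∈ secSub M v := mem_secSub.2 ⟨g, hg, hv, rfl⟩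

theorem secSub_mono {M N : Subgroup (treeAut p)} (h : M ≤ N) (v : Vertex p) :
    secSub M v ≤ secSub N v := by
  intro x hx
  obtain ⟨g, hg, hv, rfl⟩ := mem_secSub.1 hx
  exact sec_mem_secSub (h hg) hv

theorem relIndex_secSub_ne_zero {D M : Subgroup (treeAut p)} (h : D.relIndex M ≠ 0)
    (v : Vertex p) : (secSub D v).relIndex (secSub M v) ≠ 0 :=
  relIndex_map_ne_zero _ (Subgroup.relIndex_comap_ne_zero _ h)

theorem secSub_append (M : Subgroup (treeAut p)) (v w : Vertex p) :
    secSub (secSub M v) w ≤ secSub M (v ++ w) := by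
  intro x hx
  obtain ⟨h, hh, hw, rfl⟩ := mem_secSub.1 hx
  obtain ⟨g, hg, hv, rfl⟩ := mem_secSub.1 hh
  exact mem_secSub.2 ⟨g, hg, by rw [smul_append, hv, hw], sec_append g v w⟩

/-- A group that contains a product of conjugates of a subgroup of finite index, one below each
vertex of some level, has finite index. -/
theorem relIndex_ne_zero_of_graft {G F N : Subgroup (treeAut p)} {n : ℕ}
    (hG : ∀ g ∈ G, ∀ v, sec g v ∈ G) (hF : F.relIndex G ≠ 0)
    (hN : ∀ u : Vertex p, u.length = n → ∀ x ∈ F, graft u x ∈ N) : N.relIndex G ≠ 0 := by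
  have : Finite {v : Vertex p // v.length = n} := (List.finite_length_eq (Fin p) n).to_subtype
  let E : Subgroup (treeAut p) := ⨅ v : {v : Vertex p // v.length = n},
    (F.comap (secHom v.1)).map (MulAction.stabilizer (treeAut p) v.1).subtype
  have hE {g : treeAut p} (hg : g ∈ E) (v : Vertex p) (hv : v.length = n) :
      g • v = v ∧ sec g v ∈ F := by
    obtain ⟨⟨g', hg'⟩, h1, rfl⟩ := (Subgroup.mem_iInf.1 hg) ⟨v, hv⟩
    exact ⟨hg', h1⟩
  have h1 : E.relIndex G ≠ 0 := by
    refine Subgroup.relIndex_iInf_ne_zero fun v => ?_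
    have h2 : (F.comap (secHom v.1)).relIndex (G.comap (secHom v.1)) ≠ 0 :=
      Subgroup.relIndex_comap_ne_zero _ hF
    have h3 := relIndex_map_ne_zero (MulAction.stabilizer (treeAut p) v.1).subtype h2
    have h4 : (MulAction.stabilizer (treeAut p) v.1 ⊓ G) ≤
        (G.comap (secHom v.1)).map (MulAction.stabilizer (treeAut p) v.1).subtype :=
      fun g hg => ⟨⟨g, hg.1⟩, hG g hg.2 v.1, rfl⟩
    have h5 := fun h => h3 (Subgroup.relIndex_eq_zero_of_le_right h4 h)
    refine Subgroup.relIndex_ne_zero_trans h5 ?_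
    rw [Subgroup.inf_relIndex_right]
    exact relIndex_stabilizer_ne_zero _ _
  refine relIndex_ne_zero_of_le (fun g hg => ?_) h1
  classical
  -- An element of `E` is assembled from grafts of its sections, one vertex at a time; `U` is the
  -- set of vertices already treated.
  have key : ∀ U : Finset (Vertex p), (∀ u ∈ U, u.length = n) → ∃ d ∈ N, d ∈ levelFix p n ∧
      ∀ v : Vertex p, v.length = n → sec d v = if v ∈ U then sec g v else 1 := by
    intro U
    induction U using Finset.induction_on with
    | empty => exact fun _ => ⟨1, one_mem _, one_mem _, fun v _ => by simp⟩
    | insert u U hu ih =>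
      intro hU
      obtain ⟨d, hd, hd1, hd2⟩ := ih fun w hw => hU w (Finset.mem_insert_of_mem hw)
      have hul : u.length = n := hU u (Finset.mem_insert_self u U)
      refine ⟨graft u (sec g u) * d, mul_mem (hN u hul _ (hE hg u hul).2) hd,
        mul_mem (fun v hv => graft_fix u v _ (hv.trans hul.symm)) hd1, fun v hv => ?_⟩
      rw [sec_mul, hd1 v hv, hd2 v hv]
      rcases eq_or_ne v u with rfl | hvu
      · simp [hu]
      · simp [sec_graft_of_ne _ (hv.trans hul.symm) hvu, hvu]
  obtain ⟨d, hd, hd1, hd2⟩ := key (List.finite_length_eq (Fin p) n).toFinset (by simp)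
  have : g = d := ext_level n (fun v hv => by rw [(hE hg v hv).1, hd1 v hv]) fun v hv => by
    rw [hd2 v hv, if_pos (by simpa using hv)]
  exact this ▸ hd

/-! ### Subgroups normalized by a group -/

section Normalized

variable {Γ : Type*} [Group Γ]

/-- The subgroup `A` is normalized by `G`. -/
def NormalizedBy (G A : Subgroup Γ) : Prop := ∀ g ∈ G, ∀ x ∈ A, g * x * g⁻¹ ∈ A

theorem normalizedBy_self (G : Subgroup Γ) : NormalizedBy G G :=
  fun _ hg _ hx => mul_mem (mul_mem hg hx) (inv_mem hg)

theorem NormalizedBy.commutator {G A : Subgroup Γ} (h : NormalizedBy G A) :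
    NormalizedBy G ⁅A, A⁆ := by
  intro g hg x hx
  have : ⁅A, A⁆ ≤ (⁅A, A⁆ : Subgroup Γ).comap (MulAut.conj g).toMonoidHom :=
    Subgroup.commutator_le.2 fun y hy z hz => by
      rw [Subgroup.mem_comap, map_commutatorElement]
      exact Subgroup.commutator_mem_commutator (h g hg y hy) (h g hg z hz)
  exact this hx

/-- The elements of `G` that commute with `x` modulo `A`. -/
def centralizerMod {G A : Subgroup Γ} (h : NormalizedBy G A) (x : Γ) : Subgroup Γ where
  carrier := {z | z ∈ G ∧ ⁅x, z⁆ ∈ A}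
  one_mem' := ⟨one_mem _, by simp⟩
  mul_mem' := by
    rintro z w ⟨hz, hxz⟩ ⟨hw, hxw⟩
    refine ⟨mul_mem hz hw, ?_⟩
    have : ⁅x, z * w⁆ = ⁅x, z⁆ * (z * ⁅x, w⁆ * z⁻¹) := by
      simp only [commutatorElement_def]; group
    rw [this]
    exact mul_mem hxz (h z hz _ hxw)
  inv_mem' := by
    rintro z ⟨hz, hxz⟩
    refine ⟨inv_mem hz, ?_⟩
    have : ⁅x, z⁻¹⁆ = z⁻¹ * ⁅x, z⁆⁻¹ * (z⁻¹)⁻¹ := by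
      simp only [commutatorElement_def]; group
    rw [this]
    exact h _ (inv_mem hz) _ (inv_mem hxz)

theorem commutator_mem_symm {A : Subgroup Γ} {x y : Γ} (h : ⁅x, y⁆ ∈ A) : ⁅y, x⁆ ∈ A := by
  rw [← commutatorElement_inv]; exact inv_mem h

/-- Commuting with a fixed element modulo `A` is a subgroup condition, so generators suffice, in one
slot and then in the other. -/
theorem commutator_le_of_closure {S : Set Γ} {A : Subgroup Γ}
    (h : NormalizedBy (Subgroup.closure S) A) (hS : ∀ s ∈ S, ∀ t ∈ S, ⁅s, t⁆ ∈ A) :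
    ⁅Subgroup.closure S, Subgroup.closure S⁆ ≤ A := by
  have h1 : ∀ s ∈ S, Subgroup.closure S ≤ centralizerMod h s := fun s hs =>
    (Subgroup.closure_le _).2 fun t ht => ⟨Subgroup.subset_closure ht, hS s hs t ht⟩
  refine Subgroup.commutator_le.2 fun g hg k hk => ?_
  have h2 : Subgroup.closure S ≤ centralizerMod h k := (Subgroup.closure_le _).2 fun t ht =>
    ⟨Subgroup.subset_closure ht, commutator_mem_symm (h1 t ht hk).2⟩
  exact commutator_mem_symm (h2 hg).2

end Normalized

section Prime

variable [hpr : Fact p.Prime] {W : AddSubgroup (Fin (p - 1) → ZMod p)}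

theorem fg_spinal : (spinal W).FG :=
  (Subgroup.fg_iff _).2 ⟨_, rfl, ((Set.toFinite (W : Set (Fin (p - 1) → ZMod p))).image _).insert _⟩

theorem sec_mem {g : treeAut p} (hg : g ∈ spinal W) (v : Vertex p) : sec g v ∈ spinal W := by
  induction v generalizing g with
  | nil => simpa using hg
  | cons x u ih =>
    rw [sec_cons]
    refine ih ?_
    obtain ⟨n, f, h⟩ := Len.exists_of_mem hg
    obtain ⟨ℓ, φ, h1, -⟩ := h.sections
    exact (h1 x).mem.1

/-! ### Torsion forces exponent vectors of sum zero -/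

theorem Len.eq_of_one {n : ℕ} {f : Fin (p - 1) → ZMod p} {g : treeAut p} (h : Len W n f g)
    (hn : n = 1) : ∃ i j : ℕ, g = aut_a p ^ i * aut_b f * aut_a p ^ j := by
  cases h with
  | pow s => omega
  | step e s h he =>
    cases h with
    | pow t => exact ⟨t, s, by rw [zero_add]⟩
    | step => omega

/-- If the sum `σ` were nonzero modulo `p`, then `g = a ^ σ * aut_b e` would be conjugate to a
section of `g ^ p`, whose order is strictly smaller. -/
theorem sum_expo_eq_zero (htors : ∀ g ∈ spinal W, IsOfFinOrder g) {e : Fin (p - 1) → ZMod p}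
    (he : e ∈ W) : ∑ x, expo e x = 0 := by
  by_contra hne
  set σ : ℕ := ∑ x, (expo e x).val with hσ
  have hσ' : σ • (1 : Fin p) ≠ 0 := by
    rw [Ne, nsmul_one_eq_zero_iff, ← CharP.cast_eq_zero_iff (ZMod p) p, hσ]
    simpa using hne
  set g := aut_a p ^ σ * aut_b e with hg
  have hgm : g ∈ spinal W := mul_mem (pow_mem aut_a_mem σ) (aut_b_mem he)
  have hrot : Rot g (σ • 1) := by simpa using (rot_aut_a_pow σ).mul (rot_aut_b e)
  have hlen : Len W 1 e g := by simpa using (Len.pow σ).mul (Len.letter he)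
  have hsec (x : Fin p) : Rot (sec g [x]) ((expo e x).val • 1) := by
    rw [hg, sec_mul, aut_b_smul_singleton, sec_aut_a_pow, one_mul]
    rcases eq_or_ne x (lastLetter p) with rfl | hx
    · rw [sec_aut_b_last, expo_last]
      simpa using rot_aut_b e
    · rw [sec_aut_b_of_ne _ hx]
      exact rot_aut_a_pow _
  obtain ⟨h1, h2⟩ := hlen.sec_pow_prime hrot hσ' hsec 0
  obtain ⟨i, j, hij⟩ := h1.eq_of_one rfl
  -- The rotation of the section is computed twice: from its one-letter word, and as the sum of the
  -- rotations of all first-level sections of `g`.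
  have h3 : aut_a p ^ (j + i) = aut_a p ^ σ := by
    have h4 : Rot (sec (g ^ p) [0]) (i • 1 + 0 + j • 1) := by
      rw [hij]
      exact ((rot_aut_a_pow i).mul (rot_aut_b e)).mul (rot_aut_a_pow j)
    have h5 := h2.eq h4
    rw [← Finset.sum_smul, ← hσ, add_zero] at h5
    refine ext_smul ?_
    rintro (_ | ⟨x, u⟩)
    · simp
    · rw [aut_a_pow_smul_cons, aut_a_pow_smul_cons, h5, add_nsmul, add_comm (j • _)]
  have h4 : g = MulAut.conj (aut_a p ^ j) (sec (g ^ p) [0]) := by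
    rw [hij, MulAut.conj_apply, hg, ← h3, pow_add]
    group
  have h5 := (orderOf_sec_pow_lt (htors g hgm) hrot hσ' 0).2
  conv_rhs at h5 => rw [h4]
  rw [← MulEquiv.coe_toMonoidHom, orderOf_injective _ (MulEquiv.injective _)] at h5
  exact lt_irrefl _ h5

theorem exists_two_expo_ne_zero {e : Fin (p - 1) → ZMod p} (hsum : ∑ x, expo e x = 0)
    (he : e ≠ 0) : ∃ k k', k ≠ k' ∧ k ≠ lastLetter p ∧ k' ≠ lastLetter p ∧ expo e k ≠ 0 ∧
      expo e k' ≠ 0 := by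
  obtain ⟨k, hk, hk0⟩ := exists_expo_ne_zero he
  by_contra! h
  refine hk0 ?_
  rw [← hsum, Finset.sum_eq_single k (fun k' _ hk' => ?_) (by simp)]
  rcases eq_or_ne k' (lastLetter p) with rfl | hl
  · exact expo_last e
  · exact h k k' hk'.symm hk hl hk0

/-- If all `p - 1` entries were equal to `c`, their sum would be `-c`. -/
theorem exists_expo_ne {e : Fin (p - 1) → ZMod p} (hsum : ∑ x, expo e x = 0)
    (he : e ≠ 0) : ∃ k k', k ≠ lastLetter p ∧ k' ≠ lastLetter p ∧ expo e k ≠ expo e k' := by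
  obtain ⟨k, hk, hk0⟩ := exists_expo_ne_zero he
  by_contra! h
  refine hk0 ?_
  rw [← Finset.add_sum_erase _ _ (Finset.mem_univ (lastLetter p)), expo_last, zero_add,
    Finset.sum_congr rfl fun x hx => (h k x hk (Finset.ne_of_mem_erase hx)).symm,
    Finset.sum_const, Finset.card_erase_of_mem (Finset.mem_univ _), Finset.card_univ,
    Fintype.card_fin, nsmul_eq_mul, Nat.cast_sub hpr.out.one_lt.le] at hsum
  simpa using hsum

/-! ### Conjugates of the letters and fractality -/

/-- The conjugate of `aut_b e` by `a ^ d`, whose section at `i` is that of `aut_b e` at `i + d`. -/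
def bConj (e : Fin (p - 1) → ZMod p) (d : Fin p) : treeAut p :=
  (aut_a p ^ (d : ℕ))⁻¹ * aut_b e * aut_a p ^ (d : ℕ)

theorem aut_a_pow_val_smul (d i : Fin p) : aut_a p ^ (d : ℕ) • [i] = [i + d] := by
  rw [aut_a_pow_smul_cons, val_nsmul_one]

theorem bConj_fix (e : Fin (p - 1) → ZMod p) (d i : Fin p) : bConj e d • [i] = [i] :=
  (sec_conj (by rw [aut_a_pow_val_smul, aut_b_smul_singleton])).1

theorem sec_bConj (e : Fin (p - 1) → ZMod p) (d i : Fin p) :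
    sec (bConj e d) [i] = sec (aut_b e) [i + d] := by
  rw [bConj, (sec_conj (by rw [aut_a_pow_val_smul, aut_b_smul_singleton])).2, sec_aut_a_pow,
    aut_a_pow_val_smul, inv_one, one_mul, mul_one]

theorem bConj_mem {e : Fin (p - 1) → ZMod p} (he : e ∈ W) (d : Fin p) : bConj e d ∈ spinal W :=
  mul_mem (mul_mem (inv_mem (pow_mem aut_a_mem _)) (aut_b_mem he)) (pow_mem aut_a_mem _)

theorem sec_bConj_last (e : Fin (p - 1) → ZMod p) (i : Fin p) :
    sec (bConj e (lastLetter p - i)) [i] = aut_b e := by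
  rw [sec_bConj, add_sub_cancel, sec_aut_b_last]

theorem sec_bConj_of_ne (e : Fin (p - 1) → ZMod p) (i : Fin p) {k : Fin p}
    (hk : k ≠ lastLetter p) : sec (bConj e (k - i)) [i] = aut_a p ^ (expo e k).val := by
  rw [sec_bConj, add_sub_cancel, sec_aut_b_of_ne _ hk]

theorem aut_a_mem_of_pow_mem {M : Subgroup (treeAut p)} {s : ZMod p} (hs : s ≠ 0)
    (h : aut_a p ^ s.val ∈ M) : aut_a p ∈ M := by
  obtain ⟨t, ht⟩ := exists_aut_a_pow_pow hs
  exact ht ▸ pow_mem h t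

theorem fix_of_fix {g : treeAut p} (hg : g ∈ spinal W) {i : Fin p} (h : g • [i] = [i]) (j : Fin p) :
    g • [j] = [j] := by
  obtain ⟨s, hs⟩ := exists_rot hg
  have : s = 0 := by simpa using (hs i).symm.trans h
  rw [hs j, this, add_zero]

theorem spinal_le {M : Subgroup (treeAut p)} (ha : aut_a p ∈ M) (hb : ∀ e ∈ W, aut_b e ∈ M) :
    spinal W ≤ M := by
  refine (Subgroup.closure_le _).2 (Set.insert_subset ha ?_)
  rintro _ ⟨e, he, rfl⟩
  exact hb e he

/-- Conjugating letters by powers of `a` places at `i` either the letter itself or a nontrivial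
power of `a`. -/
theorem spinal_le_secSub_singleton {e : Fin (p - 1) → ZMod p} (heW : e ∈ W) (he : e ≠ 0)
    (i : Fin p) : spinal W ≤ secSub (spinal W) [i] := by
  refine spinal_le ?_ fun f hf => ?_
  · obtain ⟨k, hk, hk0⟩ := exists_expo_ne_zero he
    exact aut_a_mem_of_pow_mem hk0
      (mem_secSub.2 ⟨_, bConj_mem heW (k - i), bConj_fix _ _ _, sec_bConj_of_ne e i hk⟩)
  · exact mem_secSub.2 ⟨_, bConj_mem hf _, bConj_fix _ _ _, sec_bConj_last f i⟩

theorem spinal_le_secSub {e : Fin (p - 1) → ZMod p} (heW : e ∈ W) (he : e ≠ 0)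
    (v : Vertex p) : spinal W ≤ secSub (spinal W) v := by
  induction v with
  | nil => exact fun g hg => mem_secSub.2 ⟨g, hg, by simp, by simp⟩
  | cons x u ih =>
    refine le_trans (ih.trans (secSub_mono (spinal_le_secSub_singleton heW he x) u)) ?_
    exact secSub_append _ [x] u

theorem NormalizedBy.secSub {A : Subgroup (treeAut p)} (hA : NormalizedBy (spinal W) A)
    {e : Fin (p - 1) → ZMod p} (heW : e ∈ W) (he : e ≠ 0) (v : Vertex p) :
    NormalizedBy (spinal W) (secSub A v) := by
  intro g hg x hx
  obtain ⟨h, hh, hv, rfl⟩ := mem_secSub.1 (spinal_le_secSub heW he v hg)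
  obtain ⟨y, hy, hyv, rfl⟩ := mem_secSub.1 hx
  refine mem_secSub.2 ⟨_, hA h hh y hy, ?_, ?_⟩
  · rw [mul_smul, mul_smul, inv_smul_of_fix hv, hyv, hv]
  · rw [sec_mul, sec_mul, inv_smul_of_fix hv, hyv, sec_inv_of_fix hv]

/-! ### The group is regular branch over its second derived subgroup -/

/-- Letters commute with each other, so only commutators of letters with `a` matter, and a
nontrivial power of `a` generates `⟨a⟩`. -/
theorem commutator_spinal_le {A : Subgroup (treeAut p)} (hA : NormalizedBy (spinal W) A)
    {s : ZMod p} (hs : s ≠ 0) (h : ∀ e ∈ W, ⁅aut_b e, aut_a p ^ s.val⁆ ∈ A) :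
    ⁅spinal W, spinal W⁆ ≤ A := by
  have key : ∀ e ∈ W, ⁅aut_b e, aut_a p⁆ ∈ A := fun e he =>
    (aut_a_mem_of_pow_mem (M := centralizerMod hA (aut_b e)) hs
      ⟨pow_mem aut_a_mem _, h e he⟩).2
  refine commutator_le_of_closure hA ?_
  rintro _ (rfl | ⟨e, he, rfl⟩) _ (rfl | ⟨f, hf, rfl⟩)
  · rw [commutatorElement_self]; exact one_mem _
  · exact commutator_mem_symm (key f hf)
  · exact key e he
  · rw [commutatorElement_eq_one_iff_mul_comm.2 (aut_b_comm e f)]; exact one_mem _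

variable (W) in
/-- The second derived subgroup. -/
def derivedTwo : Subgroup (treeAut p) := ⁅⁅spinal W, spinal W⁆, ⁅spinal W, spinal W⁆⁆

theorem normalizedBy_derived : NormalizedBy (spinal W) ⁅spinal W, spinal W⁆ :=
  (normalizedBy_self _).commutator

theorem normalizedBy_derivedTwo : NormalizedBy (spinal W) (derivedTwo W) :=
  normalizedBy_derived.commutator

theorem derived_le : ⁅spinal W, spinal W⁆ ≤ spinal W :=
  Subgroup.commutator_le.2 fun _ hx _ hy =>
    mul_mem (mul_mem (mul_mem hx hy) (inv_mem hx)) (inv_mem hy)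

theorem derivedTwo_le_derived : derivedTwo W ≤ ⁅spinal W, spinal W⁆ :=
  Subgroup.commutator_mono derived_le derived_le

theorem relIndex_derivedTwo_ne_zero (htors : ∀ g ∈ spinal W, IsOfFinOrder g) :
    (derivedTwo W).relIndex (spinal W) ≠ 0 :=
  relIndex_commutator_ne_zero fg_spinal htors derived_le
    (relIndex_commutator_ne_zero fg_spinal htors le_rfl (by simp))

variable (W) in
/-- The sections at `i` of the elements of the derived subgroup whose only other nontrivial first
level section is the one at `d`. -/
def secPair (i d : Fin p) : Subgroup (treeAut p) where
  carrier := {x | ∃ h ∈ ⁅spinal W, spinal W⁆, (∀ j : Fin p, h • [j] = [j]) ∧ sec h [i] = x ∧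
    ∀ j, j ≠ i → j ≠ d → sec h [j] = 1}
  one_mem' := ⟨1, one_mem _, by simp, by simp, by simp⟩
  mul_mem' := by
    rintro _ _ ⟨h, hh, h1, rfl, h2⟩ ⟨k, hk, k1, rfl, k2⟩
    refine ⟨h * k, mul_mem hh hk, fun j => by rw [mul_smul, k1, h1], by rw [sec_mul, k1],
      fun j hi hd => by rw [sec_mul, k1, h2 j hi hd, k2 j hi hd, one_mul]⟩
  inv_mem' := by
    rintro _ ⟨h, hh, h1, rfl, h2⟩
    exact ⟨h⁻¹, inv_mem hh, fun j => inv_smul_of_fix (h1 j), sec_inv_of_fix (h1 i),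
      fun j hi hd => by rw [sec_inv_of_fix (h1 j), h2 j hi hd, inv_one]⟩

/-- Two suitable conjugates of letters have powers of `a` as sections except at one vertex each, so
their commutator is trivial elsewhere. At `i` it is a letter against a nontrivial power of `a`, and
fractality makes these sections a normalized subgroup. -/
theorem derived_le_secPair {e : Fin (p - 1) → ZMod p} (heW : e ∈ W) {k : Fin p}
    (hk : k ≠ lastLetter p) (hk0 : expo e k ≠ 0) (i : Fin p) :
    ⁅spinal W, spinal W⁆ ≤ secPair W i (lastLetter p - k + i) := by
  have he : e ≠ 0 := by rintro rfl; exact hk0 (by simp [expo])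
  have hnorm : NormalizedBy (spinal W) (secPair W i (lastLetter p - k + i)) := by
    rintro g hg _ ⟨h, hh, h1, rfl, h2⟩
    obtain ⟨q, hq, hqi, rfl⟩ := mem_secSub.1 (spinal_le_secSub heW he [i] hg)
    have q1 := fix_of_fix hq hqi
    refine ⟨q * h * q⁻¹, normalizedBy_derived q hq h hh, fun j => ?_, ?_, fun j hi hd => ?_⟩
    · rw [mul_smul, mul_smul, inv_smul_of_fix (q1 j), h1, q1]
    · rw [sec_mul, sec_mul, inv_smul_of_fix (q1 i), h1, sec_inv_of_fix (q1 i)]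
    · rw [sec_mul, sec_mul, inv_smul_of_fix (q1 j), h1, sec_inv_of_fix (q1 j), h2 j hi hd, mul_one,
        mul_inv_cancel]
  refine commutator_spinal_le hnorm hk0 fun f hf => ?_
  refine ⟨⁅bConj f (lastLetter p - i), bConj e (k - i)⁆,
    Subgroup.commutator_mem_commutator (bConj_mem hf _) (bConj_mem heW _), fun j => ?_, ?_,
    fun j hi hd => ?_⟩
  · simp only [commutatorElement_def, mul_smul, inv_smul_of_fix (bConj_fix _ _ _), bConj_fix]
  · rw [sec_commutator (bConj_fix _ _ _) (bConj_fix _ _ _), sec_bConj_last, sec_bConj_of_ne _ _ hk]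
  · rw [sec_commutator (bConj_fix _ _ _) (bConj_fix _ _ _), sec_bConj, sec_bConj,
      sec_aut_b_of_ne, sec_aut_b_of_ne, commutatorElement_eq_one_iff_mul_comm, ← pow_add,
      ← pow_add, add_comm]
    · intro h
      refine hd ?_
      rw [← h]; abel
    · intro h
      refine hi ?_
      have : j + (lastLetter p - i) = lastLetter p - i + i := by rw [h]; abel
      rw [add_comm] at this
      exact add_left_cancel this

/-- Two nonzero entries give two lifts of elements of `G'` whose supports meet only at `i`; the
commutator of the lifts is supported at `i` alone. -/
theorem graft_singleton_mem_derivedTwo {e : Fin (p - 1) → ZMod p} (heW : e ∈ W) (he : e ≠ 0)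
    (hsum : ∑ x, expo e x = 0) (i : Fin p) {x : treeAut p} (hx : x ∈ derivedTwo W) :
    ofSections (Pi.mulSingle i x) ∈ derivedTwo W := by
  obtain ⟨k, k', hkk, hk, hk', hk0, hk0'⟩ := exists_two_expo_ne_zero hsum he
  have : derivedTwo W ≤ (derivedTwo W).comap
      (ofSections.comp (MonoidHom.mulSingle (fun _ : Fin p => treeAut p) i)) := by
    refine Subgroup.commutator_le.2 fun y hy z hz => ?_
    obtain ⟨g, hg, g1, rfl, g2⟩ := derived_le_secPair heW hk hk0 i hy
    obtain ⟨h, hh, h1, rfl, h2⟩ := derived_le_secPair heW hk' hk0' i hz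
    have hfix (j : Fin p) : ⁅g, h⁆ • [j] = [j] := by
      simp only [commutatorElement_def, mul_smul, inv_smul_of_fix (g1 _), g1,
        inv_smul_of_fix (h1 _), h1]
    have : ⁅g, h⁆ = ofSections (Pi.mulSingle i ⁅sec g [i], sec h [i]⁆) := by
      rw [eq_ofSections hfix]
      congr 1
      funext j
      rw [sec_commutator (g1 j) (h1 j)]
      rcases eq_or_ne j i with rfl | hj
      · rw [Pi.mulSingle_eq_same]
      · rw [Pi.mulSingle_eq_of_ne hj]
        by_cases hjk : j = lastLetter p - k + i
        · rw [h2 j hj, commutatorElement_one_right]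
          rintro rfl
          exact hkk (sub_right_injective (add_right_cancel hjk)).symm
        · rw [g2 j hj hjk, commutatorElement_one_left]
    have h3 := Subgroup.commutator_mem_commutator hg hh
    rw [this] at h3
    exact h3
  exact this hx

theorem graft_mem_derivedTwo {e : Fin (p - 1) → ZMod p} (heW : e ∈ W) (he : e ≠ 0)
    (hsum : ∑ x, expo e x = 0) (u : Vertex p) {x : treeAut p} (hx : x ∈ derivedTwo W) :
    graft u x ∈ derivedTwo W := by
  induction u with
  | nil => exact hx
  | cons i u ih => exact graft_singleton_mem_derivedTwo heW he hsum i ih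

/-! ### Sections of level stabilizers -/

/-- If `aut_b f` commutes with `a` modulo `A`, then all its conjugates by powers of `a` agree modulo
`A`. -/
theorem bConj_div_mem {A : Subgroup (treeAut p)} (hA : NormalizedBy (spinal W) A)
    {f : Fin (p - 1) → ZMod p} (h : ⁅aut_b f, aut_a p⁆ ∈ A) (d d' : Fin p) :
    bConj f d * (bConj f d')⁻¹ ∈ A := by
  have key (d : Fin p) : bConj f d * (aut_b f)⁻¹ ∈ A := by
    have h1 : aut_a p ∈ centralizerMod hA (aut_b f) := ⟨aut_a_mem, h⟩
    have h2 := commutator_mem_symm (inv_mem (pow_mem h1 (d : ℕ))).2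
    rwa [commutatorElement_def, inv_inv] at h2
  have : bConj f d * (bConj f d')⁻¹ = bConj f d * (aut_b f)⁻¹ * (bConj f d' * (aut_b f)⁻¹)⁻¹ := by
    group
  rw [this]
  exact mul_mem (key d) (inv_mem (key d'))

theorem bConj_div_fix (f : Fin (p - 1) → ZMod p) (d d' i : Fin p) :
    (bConj f d * (bConj f d')⁻¹) • [i] = [i] := by
  rw [mul_smul, inv_smul_of_fix (bConj_fix _ _ _), bConj_fix]

theorem sec_bConj_div (f : Fin (p - 1) → ZMod p) (d d' i : Fin p) :
    sec (bConj f d * (bConj f d')⁻¹) [i] = sec (bConj f d) [i] * (sec (bConj f d') [i])⁻¹ := by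
  rw [sec_mul, inv_smul_of_fix (bConj_fix _ _ _), sec_inv_of_fix (bConj_fix _ _ _)]

theorem aut_a_pow_val_div (s t : ZMod p) :
    aut_a p ^ s.val * (aut_a p ^ t.val)⁻¹ = aut_a p ^ (s - t).val := by
  rw [mul_inv_eq_iff_eq_mul, ← aut_a_pow_val_add, sub_add_cancel]

theorem aut_a_mem_secSub {A : Subgroup (treeAut p)} (hA : NormalizedBy (spinal W) A)
    {f : Fin (p - 1) → ZMod p} (h : ⁅aut_b f, aut_a p⁆ ∈ A) {k k' : Fin p}
    (hk : k ≠ lastLetter p) (hk' : k' ≠ lastLetter p) (hne : expo f k ≠ expo f k') (i : Fin p) :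
    aut_a p ∈ secSub A [i] := by
  refine aut_a_mem_of_pow_mem (sub_ne_zero.2 hne) (mem_secSub.2
    ⟨_, bConj_div_mem hA h (k - i) (k' - i), bConj_div_fix _ _ _ _, ?_⟩)
  rw [sec_bConj_div, sec_bConj_of_ne _ _ hk, sec_bConj_of_ne _ _ hk', aut_a_pow_val_div]

theorem aut_b_mem_secSub {A : Subgroup (treeAut p)} (hA : NormalizedBy (spinal W) A)
    {f : Fin (p - 1) → ZMod p} (h : ⁅aut_b f, aut_a p⁆ ∈ A) {k : Fin p}
    (hk : k ≠ lastLetter p) {i : Fin p} (ha : aut_a p ∈ secSub A [i]) :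
    aut_b f ∈ secSub A [i] := by
  have h1 := sec_mem_secSub (bConj_div_mem hA h (lastLetter p - i) (k - i))
    (bConj_div_fix _ _ _ i)
  rw [sec_bConj_div, sec_bConj_last, sec_bConj_of_ne _ _ hk] at h1
  simpa using mul_mem h1 (pow_mem ha (expo f k).val)

theorem commutator_mem_secSub_derivedTwo {f : Fin (p - 1) → ZMod p} (hf : f ∈ W) (hf0 : f ≠ 0)
    {k k' : Fin p} (hk : k ≠ lastLetter p) (hk' : k' ≠ lastLetter p)
    (hne : expo f k ≠ expo f k') (i : Fin p) : ⁅aut_b f, aut_a p⁆ ∈ secSub (derivedTwo W) [i] := by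
  have hc : ⁅aut_b f, aut_a p⁆ ∈ ⁅spinal W, spinal W⁆ :=
    Subgroup.commutator_mem_commutator (aut_b_mem hf) aut_a_mem
  have hX := bConj_div_mem normalizedBy_derived hc (lastLetter p - i) (k - i)
  have hY := bConj_div_mem normalizedBy_derived hc (k - i) (k' - i)
  have h1 := Subgroup.commutator_mem_commutator hX hY
  have h2 := sec_mem_secSub (M := derivedTwo W) h1 (v := [i]) (by
    simp only [commutatorElement_def, mul_smul, inv_smul_of_fix (bConj_div_fix _ _ _ _),
      bConj_fix, inv_smul_of_fix (bConj_fix _ _ _)])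
  rw [sec_commutator (bConj_div_fix _ _ _ _) (bConj_div_fix _ _ _ _), sec_bConj_div, sec_bConj_div,
    sec_bConj_last, sec_bConj_of_ne _ _ hk, sec_bConj_of_ne _ _ hk', aut_a_pow_val_div] at h2
  have hcomm : Commute ((aut_a p ^ (expo f k).val)⁻¹) (aut_a p ^ (expo f k - expo f k').val) :=
    (Commute.pow_pow_self _ _ _).inv_left
  -- The extra power of `a` in the first entry commutes with the second and drops out.
  have h3 : ⁅aut_b f * (aut_a p ^ (expo f k).val)⁻¹, aut_a p ^ (expo f k - expo f k').val⁆ =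
      ⁅aut_b f, aut_a p ^ (expo f k - expo f k').val⁆ := by
    generalize aut_a p ^ (expo f k - expo f k').val = y at hcomm
    generalize (aut_a p ^ (expo f k).val)⁻¹ = x at hcomm
    rw [commutatorElement_def, commutatorElement_def, mul_assoc (aut_b f), hcomm.eq]
    group
  rw [h3] at h2
  exact (aut_a_mem_of_pow_mem (M := centralizerMod
    (normalizedBy_derivedTwo.secSub hf hf0 [i]) (aut_b f)) (sub_ne_zero.2 hne)
      ⟨pow_mem aut_a_mem _, h2⟩).2

/-- One level is spent on each gain: first `⁅aut_b f, a⁆`, then `a` and by normality its commutators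
with all letters, and finally `a` together with all letters. -/
theorem spinal_le_secSub_derivedTwo {f : Fin (p - 1) → ZMod p} (hf : f ∈ W) (hf0 : f ≠ 0)
    (hsum : ∑ x, expo f x = 0) (v : Vertex p) (hv : v.length = 3) :
    spinal W ≤ secSub (derivedTwo W) v := by
  obtain ⟨x, y, z, rfl⟩ := List.length_eq_three.1 hv
  obtain ⟨k, k', hk, hk', hne⟩ := exists_expo_ne hsum hf0
  set A₁ := secSub (derivedTwo W) [x] with hA₁
  set A₂ := secSub A₁ [y] with hA₂
  have n₁ : NormalizedBy (spinal W) A₁ := normalizedBy_derivedTwo.secSub hf hf0 [x]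
  have n₂ : NormalizedBy (spinal W) A₂ := n₁.secSub hf hf0 [y]
  have h1 := commutator_mem_secSub_derivedTwo hf hf0 hk hk' hne x
  have h2 : aut_a p ∈ A₂ := aut_a_mem_secSub n₁ h1 hk hk' hne y
  have h3 : ∀ e ∈ W, ⁅aut_b e, aut_a p⁆ ∈ A₂ := fun e he =>
    mul_mem (n₂ _ (aut_b_mem he) _ h2) (inv_mem h2)
  have h4 : aut_a p ∈ secSub A₂ [z] := aut_a_mem_secSub n₂ (h3 f hf) hk hk' hne z
  have h5 : spinal W ≤ secSub A₂ [z] :=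
    spinal_le h4 fun e he => aut_b_mem_secSub n₂ (h3 e he) hk h4
  refine h5.trans ((secSub_mono (secSub_append _ [x] [y]) [z]).trans (secSub_append _ _ [z]))

theorem spinal_le_secSub_levelFix {f : Fin (p - 1) → ZMod p} (hf : f ∈ W) (hf0 : f ≠ 0)
    (hsum : ∑ x, expo f x = 0) (m : ℕ) (v : Vertex p) (hv : v.length = m + 3) :
    spinal W ≤ secSub (spinal W ⊓ levelFix p m) v := by
  have h1 : derivedTwo W ≤ secSub (spinal W ⊓ levelFix p m) (v.take m) := fun x hx => by
    have hl : (v.take m).length = m := by simp [hv]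
    refine mem_secSub.2 ⟨graft (v.take m) x, ⟨derived_le (derivedTwo_le_derived
      (graft_mem_derivedTwo hf hf0 hsum _ hx)), fun w hw => graft_fix _ _ _ (hw.trans hl.symm)⟩,
      graft_fix _ _ _ rfl, sec_graft_self _ _⟩
  have h2 := spinal_le_secSub_derivedTwo hf hf0 hsum (v.drop m) (by simp [hv])
  have h3 := h2.trans ((secSub_mono h1 _).trans (secSub_append _ _ _))
  rwa [List.take_append_drop] at h3

end Prime

/-! ### Grafts, approximation, and kernels of sections -/

theorem graft_one (u : Vertex p) : graft u (1 : treeAut p) = 1 := by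
  induction u with
  | nil => rfl
  | cons x u ih => rw [graft_cons, ih, Pi.mulSingle_one, map_one]

theorem graft_mul (u : Vertex p) (g h : treeAut p) : graft u (g * h) = graft u g * graft u h := by
  induction u with
  | nil => rfl
  | cons x u ih => rw [graft_cons, ih, Pi.mulSingle_mul, map_mul, ← graft_cons, ← graft_cons]

/-- `graft u` as a homomorphism. -/
def graftHom (u : Vertex p) : treeAut p →* treeAut p := ⟨⟨graft u, graft_one u⟩, graft_mul u⟩

/-- As `y` moves `u`, the inner commutator has section `g⁻¹` at `u`; what it does below other
vertices is removed by the second commutator. -/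
theorem graft_commutator {u : Vertex p} {y : treeAut p} (hy : y • u ≠ u) (g h : treeAut p) :
    ⁅⁅y, graft u g⁆, graft u h⁆ = graft u ⁅g⁻¹, h⁆ := by
  have hfix (g : treeAut p) (v : Vertex p) (hv : v.length = u.length) := graft_fix u v g hv
  have hyl (v : Vertex p) (hv : v.length = u.length) : (y⁻¹ • v).length = u.length := by
    rw [length_smul, hv]
  have hc (v : Vertex p) (hv : v.length = u.length) : ⁅y, graft u g⁆ • v = v := by
    rw [commutatorElement_def, mul_smul, inv_smul_of_fix (hfix g v hv), mul_smul, mul_smul,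
      hfix g _ (hyl v hv), smul_inv_smul]
  have hs : sec ⁅y, graft u g⁆ u = g⁻¹ := by
    have h1 : y⁻¹ • u ≠ u := fun h => hy (by rw [← h, smul_inv_smul, h])
    rw [commutatorElement_def, sec_mul, inv_smul_of_fix (hfix g u rfl), sec_inv_of_fix (hfix g u rfl),
      sec_mul, sec_mul, hfix g _ (hyl u rfl), sec_graft_of_ne _ (hyl u rfl) h1, mul_one, sec_inv,
      mul_inv_cancel, one_mul, sec_graft_self]
  refine ext_level u.length (fun v hv => ?_) fun v hv => ?_
  · rw [hfix _ v hv, commutatorElement_def, mul_smul, mul_smul, mul_smul,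
      inv_smul_of_fix (hfix h v hv), inv_smul_of_fix (hc v hv), hfix h v hv, hc v hv]
  · rw [sec_commutator (hc v hv) (hfix h v hv)]
    rcases eq_or_ne v u with rfl | hvu
    · rw [hs, sec_graft_self, sec_graft_self]
    · rw [sec_graft_of_ne _ hv hvu, sec_graft_of_ne _ hv hvu, commutatorElement_one_right]

/-- Every element of `S` agrees on every level with some element of `D`. -/
def Approximates (D S : Subgroup (treeAut p)) : Prop :=
  ∀ g ∈ S, ∀ m : ℕ, ∃ d ∈ D, ∀ v : Vertex p, v.length = m → d • v = g • v

theorem Approximates.mono {D S S' : Subgroup (treeAut p)} (h : Approximates D S) (hS : S' ≤ S) :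
    Approximates D S' := fun g hg => h g (hS hg)

theorem sec_mem_levelFix {g : treeAut p} {n m : ℕ} (hg : g ∈ levelFix p (n + m)) {v : Vertex p}
    (hv : v.length = n) : sec g v ∈ levelFix p m := fun w hw => by
  simpa using sec_smul_eq_of_smul_eq (h := 1) (n := m) (v := v)
    (fun u hu => by rw [hg u (hu.trans (by rw [hv])), one_smul]) w hw

/-- The sections at `v` of the elements of `D` that act trivially below the vertices in `U`. -/
def secKer (D : Subgroup (treeAut p)) (v : Vertex p) (U : Finset (Vertex p)) :
    Subgroup (treeAut p) where
  carrier := {x | ∃ d ∈ D, d • v = v ∧ (∀ u ∈ U, d • u = u ∧ sec d u = 1) ∧ sec d v = x}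
  one_mem' := ⟨1, one_mem _, by simp, by simp, by simp⟩
  mul_mem' := by
    rintro _ _ ⟨d, hd, d1, d2, rfl⟩ ⟨e, he, e1, e2, rfl⟩
    refine ⟨d * e, mul_mem hd he, by rw [mul_smul, e1, d1], fun u hu => ?_, by rw [sec_mul, e1]⟩
    rw [mul_smul, sec_mul, (e2 u hu).1, (d2 u hu).1, (e2 u hu).2, (d2 u hu).2, one_mul]
    exact ⟨rfl, rfl⟩
  inv_mem' := by
    rintro _ ⟨d, hd, d1, d2, rfl⟩
    refine ⟨d⁻¹, inv_mem hd, inv_smul_of_fix d1, fun u hu => ?_, sec_inv_of_fix d1⟩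
    exact ⟨inv_smul_of_fix (d2 u hu).1, by rw [sec_inv_of_fix (d2 u hu).1, (d2 u hu).2, inv_one]⟩

theorem normalizedBy_secKer {D : Subgroup (treeAut p)} {n : ℕ} (hD : D ≤ levelFix p n)
    {v : Vertex p} {U : Finset (Vertex p)} (hU : ∀ u ∈ U, u.length = n) :
    NormalizedBy (secSub D v) (secKer D v U) := by
  intro g hg x hx
  obtain ⟨c, hc, hcv, rfl⟩ := mem_secSub.1 hg
  obtain ⟨d, hd, d1, d2, rfl⟩ := hx
  refine ⟨c * d * c⁻¹, mul_mem (mul_mem hc hd) (inv_mem hc), ?_, fun u hu => ?_, ?_⟩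
  · rw [mul_smul, mul_smul, inv_smul_of_fix hcv, d1, hcv]
  · have hcu := hD hc u (hU u hu)
    rw [mul_smul, mul_smul, sec_mul, sec_mul, inv_smul_of_fix hcu, (d2 u hu).1, hcu,
      (d2 u hu).2, sec_inv_of_fix hcu, mul_one, mul_inv_cancel]
    exact ⟨rfl, rfl⟩
  · rw [sec_mul, sec_mul, inv_smul_of_fix hcv, d1, sec_inv_of_fix hcv]

section Prime

variable [hpr : Fact p.Prime] {W : AddSubgroup (Fin (p - 1) → ZMod p)}

/-! ### Congruence property and approximation -/

variable (W) in
/-- The congruence subgroup property of `spinal W`, for subgroups of the automorphism group. -/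
def CongruenceProperty : Prop :=
  ∀ F : Subgroup (treeAut p), F.relIndex (spinal W) ≠ 0 → ∃ n, spinal W ⊓ levelFix p n ≤ F

theorem levelFix_anti {m n : ℕ} (h : m ≤ n) : levelFix p n ≤ levelFix p m := fun g hg v hv => by
  simpa using smul_eq_of_le (h := 1) h hpr.out.pos (fun w hw => by rw [hg w hw, one_smul]) v hv

/-- A subgroup of finite index contains a level stabilizer, so agreement on that one level is
already membership. -/
theorem Approximates.le_of_relIndex_ne_zero (hcsp : CongruenceProperty W)
    {D A : Subgroup (treeAut p)} (hDA : D ≤ A) (hA : A ≤ spinal W) (happ : Approximates D A)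
    (hD : D.relIndex (spinal W) ≠ 0) : A ≤ D := by
  obtain ⟨n, hn⟩ := hcsp D hD
  intro g hg
  obtain ⟨d, hd, hdg⟩ := happ g hg n
  have : d⁻¹ * g ∈ D := hn ⟨hA (mul_mem (inv_mem (hDA hd)) hg), fun v hv => by
    rw [mul_smul, ← hdg v hv, inv_smul_smul]⟩
  simpa using mul_mem hd this

theorem Approximates.secSub {D S : Subgroup (treeAut p)} (h : Approximates D S) (v : Vertex p) :
    Approximates (secSub D v) (secSub S v) := by
  intro g hg m
  obtain ⟨h', hh, hv, rfl⟩ := mem_secSub.1 hg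
  obtain ⟨d, hd, hdh⟩ := h h' hh (v.length + m)
  have hdv : d • v = v := (smul_eq_of_le (Nat.le_add_right _ _) hpr.out.pos hdh v rfl).trans hv
  exact ⟨sec d v, sec_mem_secSub hd hdv, sec_smul_eq_of_smul_eq hdh⟩

theorem secSub_le {M : Subgroup (treeAut p)} (hM : M ≤ spinal W) (v : Vertex p) :
    secSub M v ≤ spinal W := by
  intro x hx
  obtain ⟨g, hg, -, rfl⟩ := mem_secSub.1 hx
  exact sec_mem (hM hg) v

/-! ### Transitivity on levels -/

theorem exists_smul_eq {e : Fin (p - 1) → ZMod p} (heW : e ∈ W) (he : e ≠ 0) (u v : Vertex p)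
    (h : u.length = v.length) : ∃ g ∈ spinal W, g • u = v := by
  induction u generalizing v with
  | nil => exact ⟨1, one_mem _, by rw [smul_nil, List.length_eq_zero_iff.1 h.symm]⟩
  | cons x u ih =>
    match v, h with
    | y :: v, h =>
      obtain ⟨g, hg, hgu⟩ := ih v (by simpa using h)
      obtain ⟨n, hn⟩ := exists_aut_a_pow_smul x y
      obtain ⟨k, hk, hky, hks⟩ := mem_secSub.1 (spinal_le_secSub heW he [y] hg)
      refine ⟨k * aut_a p ^ n, mul_mem hk (pow_mem aut_a_mem n), ?_⟩
      rw [mul_smul, smul_cons, hn, sec_aut_a_pow, one_smul, smul_append, hky, hks, hgu]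
      rfl

/-- By transitivity the stabilizer of a vertex of level `l` has index `p ^ l > l`, so it cannot
contain `K` once `l` is at least the index of `K`. -/
theorem exists_forall_level_smul_ne {e : Fin (p - 1) → ZMod p} (heW : e ∈ W) (he : e ≠ 0)
    {K : Subgroup (treeAut p)} (hK : K.relIndex (spinal W) ≠ 0) (k : ℕ) :
    ∃ l, k ≤ l ∧ ∀ u : Vertex p, u.length = l → ∃ x ∈ K, x • u ≠ u := by
  refine ⟨max k (K.relIndex (spinal W)), le_max_left _ _, fun u hu => ?_⟩
  by_contra! h
  have h1 : K ≤ MulAction.stabilizer (treeAut p) u := h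
  have h2 := Subgroup.relIndex_le_of_le_left h1 hK
  have h3 : (MulAction.stabilizer (treeAut p) u).relIndex (spinal W) = p ^ u.length := by
    have h4 : (MulAction.stabilizer (treeAut p) u).subgroupOf (spinal W) =
        MulAction.stabilizer (spinal W) u := rfl
    have h5 : MulAction.orbit (spinal W) u = {v | v.length = u.length} := by
      ext v
      constructor
      · rintro ⟨g, rfl⟩
        exact length_smul g.1 u
      · intro hv
        obtain ⟨g, hg, hgu⟩ := exists_smul_eq heW he u v (by simpa using hv.symm)
        exact ⟨⟨g, hg⟩, hgu⟩
    rw [Subgroup.relIndex, h4, MulAction.index_stabilizer, h5, ← Nat.card_coe_set_eq]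
    change Nat.card (List.Vector (Fin p) u.length) = _
    rw [Nat.card_eq_fintype_card, card_vector, Fintype.card_fin]
  rw [h3, hu] at h2
  have h6 := Nat.lt_pow_self hpr.out.one_lt (n := max k (K.relIndex (spinal W)))
  have h7 := le_max_right k (K.relIndex (spinal W))
  omega

/-! ### Groups with large sections -/

/-- The sections at `v` of elements trivial below `w` approximate `G''`, so they move each vertex
`u` of some deep level. They are normalized by the sections of `D` at `v`, which contain the grafts
of `G''` at `u`; double commutators then yield the grafts of the derived subgroup of `G''`. -/
theorem relIndex_secKer_singleton_ne_zero (htors : ∀ g ∈ spinal W, IsOfFinOrder g)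
    (hcsp : CongruenceProperty W) {e : Fin (p - 1) → ZMod p} (heW : e ∈ W) (he : e ≠ 0)
    {D : Subgroup (treeAut p)} {n : ℕ} (hDG : D ≤ spinal W) (hD : D ≤ levelFix p n)
    (happ : Approximates D (spinal W ⊓ levelFix p n))
    (hsec : ∀ v : Vertex p, v.length = n → (secSub D v).relIndex (spinal W) ≠ 0)
    {v w : Vertex p} (hv : v.length = n) (hw : w.length = n) (hvw : w ≠ v) :
    (secKer D v {w}).relIndex (spinal W) ≠ 0 := by
  have hsum := sum_expo_eq_zero htors heW
  have hK := relIndex_derivedTwo_ne_zero htors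
  have hKle : derivedTwo W ≤ spinal W := derivedTwo_le_derived.trans derived_le
  have hN := normalizedBy_secKer (v := v) hD (U := {w}) (by simpa using hw)
  obtain ⟨k, hk⟩ := hcsp _ (hsec v hv)
  obtain ⟨l, hkl, hl⟩ := exists_forall_level_smul_ne heW he hK k
  have approx : ∀ x ∈ derivedTwo W, ∀ m : ℕ, ∃ y ∈ secKer D v {w},
      ∀ u : Vertex p, u.length = m → y • u = x • u := by
    intro x hx m
    have hQ : (secSub (D ⊓ levelFix p (n + m)) w).relIndex (spinal W) ≠ 0 := by
      refine Subgroup.relIndex_ne_zero_trans (relIndex_secSub_ne_zero ?_ w) (hsec w hw)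
      rw [Subgroup.inf_relIndex_left]
      exact relIndex_levelFix_ne_zero _ _
    -- The depth `m'` is such that any section at `w` trivial to that depth is cancelled exactly by
    -- an element of `D` fixing level `n + m`, which leaves the approximation at `v` intact.
    obtain ⟨m', hm'⟩ := hcsp _ hQ
    obtain ⟨d, hd, hdr⟩ := happ (graft v x)
      ⟨hKle (graft_mem_derivedTwo heW he hsum v hx), fun u hu => graft_fix v u x (hu.trans hv.symm)⟩
      (n + (m + m'))
    have h1 : sec d w ∈ levelFix p m' := fun u hu => by
      have := smul_eq_of_le (Nat.le_add_left m' m) hpr.out.pos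
        (sec_smul_eq_of_smul_eq (v := w) (hw.symm ▸ hdr)) u hu
      rwa [sec_graft_of_ne x (hw.trans hv.symm) hvw, one_smul] at this
    obtain ⟨d', ⟨hd', hd'm⟩, hd'w, hd's⟩ := mem_secSub.1 (hm' ⟨sec_mem (hDG hd) w, h1⟩)
    have hd'v := hD hd' v hv
    refine ⟨sec (d * d'⁻¹) v, ⟨d * d'⁻¹, mul_mem hd (inv_mem hd'), ?_, fun u hu => ?_, rfl⟩,
      fun u hu => ?_⟩
    · rw [mul_smul, inv_smul_of_fix hd'v, hD hd v hv]
    · rw [Finset.mem_singleton.1 hu, mul_smul, inv_smul_of_fix hd'w, hD hd w hw, sec_mul,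
        inv_smul_of_fix hd'w, sec_inv_of_fix hd'w, hd's, mul_inv_cancel]
      exact ⟨rfl, rfl⟩
    · rw [sec_mul, inv_smul_of_fix hd'v, sec_inv_of_fix hd'v, mul_smul,
        inv_smul_of_fix (sec_mem_levelFix hd'm hv u hu)]
      have := smul_eq_of_le (Nat.le_add_right m m') hpr.out.pos
        (sec_smul_eq_of_smul_eq (v := v) (hv.symm ▸ hdr)) u hu
      rwa [sec_graft_self] at this
  refine relIndex_ne_zero_of_graft (n := l) (F := ⁅derivedTwo W, derivedTwo W⁆)
    (fun g hg v => sec_mem hg v) (relIndex_commutator_ne_zero fg_spinal htors hKle hK) ?_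
  intro u hu
  obtain ⟨x, hx, hxu⟩ := hl u hu
  obtain ⟨y, hy, hyx⟩ := approx x hx l
  have hyu : y • u ≠ u := by rwa [hyx u hu]
  have hP : ∀ g ∈ derivedTwo W, graft u g ∈ secSub D v := fun g hg =>
    hk ⟨hKle (graft_mem_derivedTwo heW he hsum u hg), levelFix_anti hkl
      fun t ht => graft_fix u t g (ht.trans hu.symm)⟩
  have hcomm : ∀ z ∈ secKer D v {w}, ∀ g ∈ secSub D v, ⁅z, g⁆ ∈ secKer D v {w} :=
    fun z hz g hg => by
      rw [commutatorElement_def, mul_assoc, mul_assoc, ← mul_assoc g]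
      exact mul_mem hz (hN g hg _ (inv_mem hz))
  have : ⁅derivedTwo W, derivedTwo W⁆ ≤ (secKer D v {w}).comap (graftHom u) :=
    Subgroup.commutator_le.2 fun g hg h hh => by
      have h1 := hcomm _ (hcomm y hy _ (hP _ (inv_mem hg))) _ (hP h hh)
      rwa [graft_commutator hyu, inv_inv] at h1
  exact fun x hx => this hx

/-- A commutator of an element trivial below `U` with one trivial below `w` is trivial below both,
and passing to a derived subgroup keeps the index finite. -/
theorem relIndex_secKer_ne_zero (htors : ∀ g ∈ spinal W, IsOfFinOrder g)
    (hcsp : CongruenceProperty W) {e : Fin (p - 1) → ZMod p} (heW : e ∈ W) (he : e ≠ 0)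
    {D : Subgroup (treeAut p)} {n : ℕ} (hDG : D ≤ spinal W) (hD : D ≤ levelFix p n)
    (happ : Approximates D (spinal W ⊓ levelFix p n))
    (hsec : ∀ v : Vertex p, v.length = n → (secSub D v).relIndex (spinal W) ≠ 0)
    {v : Vertex p} (hv : v.length = n) (U : Finset (Vertex p)) (hU : ∀ u ∈ U, u.length = n)
    (hvU : v ∉ U) : (secKer D v U).relIndex (spinal W) ≠ 0 := by
  classical
  induction U using Finset.induction_on with
  | empty =>
    refine relIndex_ne_zero_of_le (fun x hx => ?_) (hsec v hv)
    obtain ⟨d, hd, hdv, rfl⟩ := mem_secSub.1 hx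
    exact ⟨d, hd, hdv, by simp, rfl⟩
  | insert w U hwU ih =>
    rw [Finset.mem_insert, not_or] at hvU
    have hw : w.length = n := hU w (Finset.mem_insert_self w U)
    have hU' : ∀ u ∈ U, u.length = n := fun u hu => hU u (Finset.mem_insert_of_mem hu)
    have h1 := ih hU' hvU.2
    have h2 := relIndex_secKer_singleton_ne_zero htors hcsp heW he hDG hD happ hsec hv hw
      (Ne.symm hvU.1)
    have h3 : secKer D v U ⊓ secKer D v {w} ≤ spinal W := by
      rintro x ⟨⟨d, hd, -, -, rfl⟩, -⟩
      exact sec_mem (hDG hd) v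
    refine relIndex_ne_zero_of_le ?_
      (relIndex_commutator_ne_zero fg_spinal htors h3 (Subgroup.relIndex_inf_ne_zero h1 h2))
    refine Subgroup.commutator_le.2 ?_
    rintro _ ⟨⟨c, hc, c1, c2, rfl⟩, -⟩ _ ⟨-, ⟨d, hd, d1, d2, rfl⟩⟩
    refine ⟨⁅c, d⁆, mul_mem (mul_mem (mul_mem hc hd) (inv_mem hc)) (inv_mem hd), ?_, fun u hu => ?_,
      sec_commutator c1 d1⟩
    · simp only [commutatorElement_def, mul_smul, inv_smul_of_fix d1, inv_smul_of_fix c1, d1, c1]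
    · have hcu := hD hc u (hU u hu)
      have hdu := hD hd u (hU u hu)
      refine ⟨by simp only [commutatorElement_def, mul_smul, inv_smul_of_fix hdu,
        inv_smul_of_fix hcu, hdu, hcu], ?_⟩
      rw [sec_commutator hcu hdu]
      rcases Finset.mem_insert.1 hu with rfl | hu
      · rw [(d2 u (Finset.mem_singleton_self u)).2, commutatorElement_one_right]
      · rw [(c2 u hu).2, commutatorElement_one_left]

/-- A group that approximates a level stabilizer and whose sections at this level are the whole
group has finite index. -/
theorem relIndex_ne_zero_of_secSub (htors : ∀ g ∈ spinal W, IsOfFinOrder g)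
    (hcsp : CongruenceProperty W) {e : Fin (p - 1) → ZMod p} (heW : e ∈ W) (he : e ≠ 0)
    {M : Subgroup (treeAut p)} {n : ℕ} (hM : M ≤ spinal W)
    (happ : Approximates M (spinal W ⊓ levelFix p n))
    (hsec : ∀ v : Vertex p, v.length = n → spinal W ≤ secSub M v) :
    M.relIndex (spinal W) ≠ 0 := by
  classical
  set D := M ⊓ levelFix p n with hDdef
  have hDG : D ≤ spinal W := inf_le_left.trans hM
  have happ' : Approximates D (spinal W ⊓ levelFix p n) := fun g hg m => by
    obtain ⟨d, hd, hdg⟩ := happ g hg (n + m)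
    refine ⟨d, ⟨hd, fun v hv => ?_⟩, smul_eq_of_le (Nat.le_add_left m n) hpr.out.pos hdg⟩
    rw [smul_eq_of_le (Nat.le_add_right n m) hpr.out.pos hdg v hv, hg.2 v hv]
  have hsec' : ∀ v : Vertex p, v.length = n → (secSub D v).relIndex (spinal W) ≠ 0 :=
    fun v hv h => by
      refine relIndex_secSub_ne_zero (D := D) (M := M) ?_ v
        (Subgroup.relIndex_eq_zero_of_le_right (hsec v hv) h)
      rw [Subgroup.inf_relIndex_left]
      exact relIndex_levelFix_ne_zero _ _
  have : Finite {v : Vertex p // v.length = n} := (List.finite_length_eq (Fin p) n).to_subtype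
  let V := (List.finite_length_eq (Fin p) n).toFinset
  have hV {u : Vertex p} : u ∈ V ↔ u.length = n := by simp [V]
  refine relIndex_ne_zero_of_le (inf_le_left : D ≤ M) (relIndex_ne_zero_of_graft (n := n)
    (F := ⨅ v : {v : Vertex p // v.length = n}, secKer D v.1 (V.erase v.1))
    (fun g hg v => sec_mem hg v) (Subgroup.relIndex_iInf_ne_zero fun v =>
      relIndex_secKer_ne_zero htors hcsp heW he hDG inf_le_right happ' hsec' v.2 _
        (fun u hu => hV.1 (Finset.mem_of_mem_erase hu)) (Finset.notMem_erase _ _)) ?_)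
  intro u hu x hx
  obtain ⟨d, hd, -, d2, rfl⟩ := (Subgroup.mem_iInf.1 hx) ⟨u, hu⟩
  have : graft u (sec d u) = d := by
    refine ext_level n (fun v hv => ?_) fun v hv => ?_
    · rw [graft_fix u v _ (hv.trans hu.symm), hd.2 v hv]
    · rcases eq_or_ne v u with rfl | hvu
      · rw [sec_graft_self]
      · rw [sec_graft_of_ne _ (hv.trans hu.symm) hvu,
          (d2 v (Finset.mem_erase.2 ⟨hvu, hV.2 hv⟩)).2]
  have h2 : graft u (sec d u) ∈ D := by rwa [this]
  exact h2

/-- Density supplies elements of `M` that carry any first-level vertex to `x`, so conjugation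
spreads the full section to the whole level. This is what lets every descent below replace `M` by a
section. -/
theorem spinal_le_of_secSub_singleton (htors : ∀ g ∈ spinal W, IsOfFinOrder g)
    (hcsp : CongruenceProperty W) {e : Fin (p - 1) → ZMod p} (heW : e ∈ W) (he : e ≠ 0)
    {M : Subgroup (treeAut p)} (hM : M ≤ spinal W) (happ : Approximates M (spinal W)) (x : Fin p)
    (hx : spinal W ≤ secSub M [x]) : spinal W ≤ M := by
  refine happ.le_of_relIndex_ne_zero hcsp hM le_rfl
    (relIndex_ne_zero_of_secSub htors hcsp heW he (n := 1) hM (happ.mono inf_le_left) ?_)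
  intro v hv g hg
  obtain ⟨y, rfl⟩ := List.length_eq_one_iff.1 hv
  obtain ⟨n, hn⟩ := exists_aut_a_pow_smul y x
  obtain ⟨m, hm, hma⟩ := happ _ (pow_mem aut_a_mem n) 1
  have hmy : m • [y] = [x] := (hma [y] rfl).trans hn
  have hs := sec_mem (hM hm) [y]
  obtain ⟨h, hh, hhx, hhs⟩ := mem_secSub.1 (hx (mul_mem (mul_mem hs hg) (inv_mem hs)))
  have h1 := sec_conj (g := m) (h := h) (v := [y]) (by rw [hmy, hhx])
  refine mem_secSub.2 ⟨_, mul_mem (mul_mem (inv_mem hm) hh) hm, h1.1, ?_⟩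
  rw [h1.2, hmy, hhs]
  group

end Prime

section Prime

variable [hpr : Fact p.Prime] {W : AddSubgroup (Fin (p - 1) → ZMod p)}

/-! ### Approximating subgroups are everything -/

variable (W) in
/-- A subgroup of `spinal W` that is dense in the congruence topology. -/
def IsDense (M : Subgroup (treeAut p)) : Prop := M ≤ spinal W ∧ Approximates M (spinal W)

theorem IsDense.secSub {e : Fin (p - 1) → ZMod p} (heW : e ∈ W) (he : e ≠ 0)
    {M : Subgroup (treeAut p)} (hM : IsDense W M) (v : Vertex p) : IsDense W (secSub M v) :=
  ⟨secSub_le hM.1 v, (hM.2.secSub v).mono (spinal_le_secSub heW he v)⟩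

variable (W) in
/-- The elements represented by a word with exponent vectors of sum zero. -/
def sumZero : Subgroup (treeAut p) where
  carrier := {g | ∃ n, Len W n 0 g}
  one_mem' := ⟨0, .one⟩
  mul_mem' := by
    rintro g h ⟨n, hg⟩ ⟨m, hh⟩
    exact ⟨n + m, by simpa using hg.mul hh⟩
  inv_mem' := by
    rintro g ⟨n, hg⟩
    exact ⟨n, by simpa using hg.inv⟩

/-- Every coset contains a single letter, and `W` is finite. -/
theorem relIndex_sumZero_ne_zero : (sumZero W).relIndex (spinal W) ≠ 0 := by
  have : Finite (spinal W ⧸ (sumZero W).subgroupOf (spinal W)) := by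
    refine Finite.of_surjective
      (fun e : W => QuotientGroup.mk (⟨aut_b e.1, aut_b_mem e.2⟩ : spinal W)) fun q => ?_
    obtain ⟨⟨g, hg⟩, rfl⟩ := QuotientGroup.mk_surjective q
    obtain ⟨n, f, h⟩ := Len.exists_of_mem hg
    refine ⟨⟨f, h.mem.2⟩, QuotientGroup.eq.2 ?_⟩
    have := (Len.letter h.mem.2).inv.mul h
    rw [neg_add_cancel] at this
    exact ⟨_, this⟩
  exact Subgroup.index_ne_zero_of_finite

/-- An element of `M` close enough to `aut_b e` differs from it by an element of `sumZero`. Only the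
existence of a word with sum `e` is claimed, not its uniqueness. -/
theorem IsDense.exists_len (hcsp : CongruenceProperty W) {M : Subgroup (treeAut p)}
    (hM : IsDense W M) {e : Fin (p - 1) → ZMod p} (he : e ∈ W) : ∃ g ∈ M, ∃ n, Len W n e g := by
  obtain ⟨m, hm⟩ := hcsp _ (relIndex_sumZero_ne_zero (W := W))
  obtain ⟨d, hd, hdb⟩ := hM.2 (aut_b e) (aut_b_mem he) m
  have hdG : d⁻¹ * aut_b e ∈ spinal W := mul_mem (inv_mem (hM.1 hd)) (aut_b_mem he)
  obtain ⟨n, hn⟩ : d⁻¹ * aut_b e ∈ sumZero W :=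
    hm ⟨hdG, fun v hv => by
      rw [mul_smul, ← hdb v hv, inv_smul_smul]⟩
  refine ⟨d, hd, 1 + n, ?_⟩
  have := (Len.letter he).mul hn.inv
  rw [neg_zero, add_zero] at this
  convert this using 1
  group

/-- Descent on the length of an element of a dense subgroup that contains `a`. -/
theorem spinal_le_of_aut_a_mem_of_len (htors : ∀ g ∈ spinal W, IsOfFinOrder g)
    (hcsp : CongruenceProperty W) {f : Fin (p - 1) → ZMod p} (hf : f ∈ W) (hf0 : f ≠ 0)
    {B : AddSubgroup (Fin (p - 1) → ZMod p)} (hfB : f ∈ B)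
    (ih : ∀ M, IsDense W M → aut_a p ∈ M → (∀ e ∈ B, aut_b e ∈ M) →
      (∃ e ∈ W, e ∉ B ∧ aut_b e ∈ M) → spinal W ≤ M)
    (n : ℕ) (M : Subgroup (treeAut p)) (hM : IsDense W M) (ha : aut_a p ∈ M)
    (hB : ∀ e ∈ B, aut_b e ∈ M) {g : treeAut p} (hg : g ∈ M) {e : Fin (p - 1) → ZMod p}
    (hlen : Len W n e g) (he : e ∉ B) : spinal W ≤ M := by
  induction n using Nat.strong_induction_on generalizing M g e with
  | _ n ihn =>
  obtain ⟨s, hs⟩ := hlen.exists_rot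
  set g' := g * aut_a p ^ ((-s : Fin p) : ℕ) with hg'
  have hg'M : g' ∈ M := mul_mem hg (pow_mem ha _)
  have hg'fix (x : Fin p) : g' • [x] = [x] := by
    rw [hg', mul_smul, aut_a_pow_val_smul, hs, neg_add_cancel_right]
  have hlen' : Len W n e g' := hlen.mul_pow _
  obtain ⟨ℓ, φ, h1, h2, h3, h4⟩ := hlen'.sections
  -- The section vectors add up to `e ∉ B`. If the chosen section is shorter, descent continues in
  -- it; otherwise the word collapses and gives the new letter `aut_b e`.
  obtain ⟨x, hx⟩ : ∃ x, φ x ∉ B := by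
    by_contra! h
    exact he (h3 ▸ sum_mem fun x _ => h x)
  rcases eq_or_ne (ℓ x) n with hxn | hxn
  · obtain ⟨i, j, hij, -⟩ := h4 x hxn
    refine ih M hM ha hB ⟨e, hlen.mem.2, he, ?_⟩
    have : aut_b e = (aut_a p ^ i)⁻¹ * g' * (aut_a p ^ j)⁻¹ := by rw [hij]; group
    rw [this]
    exact mul_mem (mul_mem (inv_mem (pow_mem ha _)) hg'M) (inv_mem (pow_mem ha _))
  · have hxlt : ℓ x < n := lt_of_le_of_ne
      (h2 ▸ Finset.single_le_sum (fun _ _ => Nat.zero_le _) (Finset.mem_univ x)) hxn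
    have hconj {e : Fin (p - 1) → ZMod p} (he : e ∈ B) (d : Fin p) : bConj e d ∈ M :=
      mul_mem (mul_mem (inv_mem (pow_mem ha _)) (hB e he)) (pow_mem ha _)
    refine spinal_le_of_secSub_singleton htors hcsp hf hf0 hM.1 hM.2 x
      (ihn (ℓ x) hxlt _ (hM.secSub hf hf0 [x]) ?_ (fun e he => ?_)
        (sec_mem_secSub hg'M (hg'fix x)) (h1 x) hx)
    · obtain ⟨k, hk, hk0⟩ := exists_expo_ne_zero hf0
      exact aut_a_mem_of_pow_mem hk0 (mem_secSub.2
        ⟨_, hconj hfB (k - x), bConj_fix _ _ _, sec_bConj_of_ne f x hk⟩)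
    · exact mem_secSub.2 ⟨_, hconj he _, bConj_fix _ _ _, sec_bConj_last e x⟩

variable (W) in
/-- The exponent vectors in `W` of the letters in `M`. -/
def letters (M : Subgroup (treeAut p)) : AddSubgroup (Fin (p - 1) → ZMod p) where
  carrier := {e | e ∈ W ∧ aut_b e ∈ M}
  zero_mem' := ⟨zero_mem _, by rw [aut_b_zero]; exact one_mem _⟩
  add_mem' := fun {e f} he hf => ⟨add_mem he.1 hf.1, by rw [aut_b_add]; exact mul_mem he.2 hf.2⟩
  neg_mem' := fun {e} he => ⟨neg_mem he.1, by rw [aut_b_neg]; exact inv_mem he.2⟩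

/-- Induction on the number of vectors in `W` whose letter is missing from `M`; the length descent
adds a new one each time. -/
theorem spinal_le_of_aut_a_mem (htors : ∀ g ∈ spinal W, IsOfFinOrder g)
    (hcsp : CongruenceProperty W) {f : Fin (p - 1) → ZMod p} (hf : f ∈ W) (hf0 : f ≠ 0)
    (M : Subgroup (treeAut p)) (hM : IsDense W M) (ha : aut_a p ∈ M) (hfM : aut_b f ∈ M) :
    spinal W ≤ M := by
  induction h : ((W : Set (Fin (p - 1) → ZMod p)) \ letters W M).ncard using
    Nat.strong_induction_on generalizing M with
  | _ c ih =>
  by_cases hall : ∀ e ∈ W, aut_b e ∈ M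
  · exact spinal_le ha hall
  · push Not at hall
    obtain ⟨e, heW, heM⟩ := hall
    obtain ⟨g, hg, n, hlen⟩ := hM.exists_len hcsp heW
    refine spinal_le_of_aut_a_mem_of_len htors hcsp hf hf0 (B := letters W M) ⟨hf, hfM⟩ ?_ n M hM ha
      (fun e he => he.2) hg hlen fun he => heM he.2
    rintro M' hM' ha' hB ⟨e', he'W, he'B, he'M⟩
    refine ih _ ?_ M' hM' ha' (hB f ⟨hf, hfM⟩) rfl
    rw [← h]
    refine Set.ncard_lt_ncard ?_ (Set.toFinite _)
    refine (Set.ssubset_iff_of_subset ?_).2 ⟨e', ⟨he'W, he'B⟩, fun h => h.2 ⟨he'W, he'M⟩⟩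
    exact Set.sdiff_subset_sdiff_right fun x hx => ⟨hx.1, hB x hx⟩

theorem IsDense.map_conj {M : Subgroup (treeAut p)} (hM : IsDense W M) {b : treeAut p}
    (hb : b ∈ spinal W) : IsDense W (M.map (MulAut.conj b).toMonoidHom) := by
  constructor
  · rintro _ ⟨m, hm, rfl⟩
    exact mul_mem (mul_mem hb (hM.1 hm)) (inv_mem hb)
  · intro g hg n
    obtain ⟨d, hd, hdg⟩ := hM.2 _ (mul_mem (mul_mem (inv_mem hb) hg) hb) n
    refine ⟨_, ⟨d, hd, rfl⟩, fun v hv => ?_⟩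
    change (b * d * b⁻¹) • v = g • v
    rw [mul_smul, mul_smul, hdg _ (by rw [length_smul, hv])]
    simp only [mul_smul, smul_inv_smul]

/-- Descent on the length of an element that conjugates `a` into a dense subgroup. -/
theorem spinal_le_of_conj_mem (htors : ∀ g ∈ spinal W, IsOfFinOrder g)
    (hcsp : CongruenceProperty W) {f : Fin (p - 1) → ZMod p} (hf : f ∈ W) (hf0 : f ≠ 0)
    (n : ℕ) (M : Subgroup (treeAut p)) (hM : IsDense W M) (hfM : aut_b f ∈ M)
    {z : treeAut p} {c : Fin (p - 1) → ZMod p} (hz : z⁻¹ * aut_a p * z ∈ M) (hlen : Len W n c z) :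
    spinal W ≤ M := by
  induction n using Nat.strong_induction_on generalizing M z c with
  | _ n ih =>
  obtain ⟨ℓ, φ, h1, h2, h3, h4⟩ := hlen.sections
  rcases eq_or_ne (ℓ (lastLetter p)) n with hl | hl
  · obtain ⟨i, j, hij, hj⟩ := h4 _ hl
    have hj1 : aut_a p ^ j = 1 := by
      rw [aut_a_pow_smul_cons] at hj
      rw [aut_a_pow_eq_one_iff]
      simpa using hj
    -- Here `z = a ^ i * aut_b c`, so conjugation by `aut_b c` brings `a` into the subgroup and
    -- keeps `aut_b f`.
    have hb := aut_b_mem hlen.mem.2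
    have h5 := spinal_le_of_aut_a_mem htors hcsp hf hf0 _ (hM.map_conj hb)
      ⟨_, hz, by
        change aut_b c * (z⁻¹ * aut_a p * z) * (aut_b c)⁻¹ = aut_a p
        rw [hij, hj1]; group⟩
      ⟨_, hfM, by
        change aut_b c * aut_b f * (aut_b c)⁻¹ = aut_b f
        rw [aut_b_comm, mul_inv_cancel_right]⟩
    intro x hx
    obtain ⟨y, hy, hyx⟩ := h5 (mul_mem (mul_mem hb hx) (inv_mem hb))
    have : y = x := (MulAut.conj (aut_b c)).injective hyx
    exact this ▸ hy
  · obtain ⟨k, k', hkk, hk, hk', hk0, hk0'⟩ :=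
      exists_two_expo_ne_zero (sum_expo_eq_zero htors hf) hf0
    have hle : ℓ (lastLetter p) + ℓ k + ℓ k' ≤ n := by
      rw [← h2, add_assoc, ← Finset.sum_pair (f := ℓ) hkk,
        ← Finset.sum_insert (s := {k, k'}) (by simp [hk.symm, hk'.symm])]
      exact Finset.sum_le_sum_of_subset (Finset.subset_univ _)
    -- If `k` and the last letter absorb everything, `k'` receives nothing, and it can replace `k`
    -- because the last letter alone receives fewer than `n`.
    obtain ⟨k, hk, hk0, hlt⟩ : ∃ k, k ≠ lastLetter p ∧ expo f k ≠ 0 ∧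
        ℓ k + ℓ (lastLetter p) < n := by
      rcases lt_or_ge (ℓ k + ℓ (lastLetter p)) n with h | h
      · exact ⟨k, hk, hk0, h⟩
      · exact ⟨k', hk', hk0', by omega⟩
    obtain ⟨s, hs⟩ := hlen.exists_rot
    obtain ⟨j, hj⟩ := exists_aut_a_pow_smul (lastLetter p + s) (k + s)
    -- The element `y` of `M` carries the last letter to `k`. Conjugating `aut_b f` by it gives, at
    -- the last letter, a power of `a` conjugated by a word of length `ℓ k + ℓ (lastLetter p) < n`.
    set y := z⁻¹ * aut_a p ^ j * z with hy
    have hyM : y ∈ M := by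
      have : y = (z⁻¹ * aut_a p * z) ^ j := by
        have := conj_pow (i := j) (a := z⁻¹) (b := aut_a p)
        rw [inv_inv] at this
        exact this.symm
      rw [this]
      exact pow_mem hz j
    have hzk : aut_a p ^ j • z • [lastLetter p] = z • [k] := by rw [hs, hj, hs]
    have hyl : y • [lastLetter p] = [k] := by
      rw [hy, mul_smul, mul_smul, hzk, inv_smul_smul]
    have hsy : sec y [lastLetter p] = (sec z [k])⁻¹ * sec z [lastLetter p] := by
      rw [hy, sec_mul, sec_mul, hzk, sec_inv_smul, hs, sec_aut_a_pow, mul_one]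
    have h5 := sec_conj (g := y) (h := aut_b f) (v := [lastLetter p]) (by
      rw [hyl, aut_b_smul_singleton])
    rw [hyl, sec_aut_b_of_ne _ hk] at h5
    have h6 : (sec y [lastLetter p])⁻¹ * aut_a p * sec y [lastLetter p] ∈
        SpinalGroup.secSub M [lastLetter p] := by
      obtain ⟨t, ht⟩ := exists_aut_a_pow_pow hk0
      have h7 := pow_mem (mem_secSub.2
        ⟨_, mul_mem (mul_mem (inv_mem hyM) hfM) hyM, h5.1, h5.2⟩) t
      have h8 := conj_pow (i := t) (a := (sec y [lastLetter p])⁻¹) (b := aut_a p ^ (expo f k).val)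
      rw [inv_inv] at h8
      rwa [h8, ht] at h7
    have h7 := (h1 k).inv.mul (h1 (lastLetter p))
    rw [← hsy] at h7
    exact spinal_le_of_secSub_singleton htors hcsp hf hf0 hM.1 hM.2 (lastLetter p)
      (ih _ hlt _ (hM.secSub hf hf0 _)
        (mem_secSub.2 ⟨_, hfM, aut_b_smul_singleton _ _, sec_aut_b_last f⟩) h6 h7)

/-- Density gives an element of `M` carrying the last letter to a place where `aut_b f` has a
nontrivial power of `a`; the conjugate it produces starts the previous descent. -/
theorem spinal_le_of_aut_b_mem (htors : ∀ g ∈ spinal W, IsOfFinOrder g)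
    (hcsp : CongruenceProperty W) {f : Fin (p - 1) → ZMod p} (hf : f ∈ W) (hf0 : f ≠ 0)
    {M : Subgroup (treeAut p)} (hM : IsDense W M) (hfM : aut_b f ∈ M) : spinal W ≤ M := by
  obtain ⟨k, hk, hk0⟩ := exists_expo_ne_zero hf0
  obtain ⟨j, hj⟩ := exists_aut_a_pow_smul (lastLetter p) k
  obtain ⟨y, hyM, hya⟩ := hM.2 _ (pow_mem aut_a_mem j) 1
  have hyl : y • [lastLetter p] = [k] := (hya _ rfl).trans hj
  have h5 := sec_conj (g := y) (h := aut_b f) (v := [lastLetter p]) (by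
    rw [hyl, aut_b_smul_singleton])
  rw [hyl, sec_aut_b_of_ne _ hk] at h5
  obtain ⟨n, c, hlen⟩ := Len.exists_of_mem (sec_mem (hM.1 hyM) [lastLetter p])
  refine spinal_le_of_secSub_singleton htors hcsp hf hf0 hM.1 hM.2 (lastLetter p)
    (spinal_le_of_conj_mem htors hcsp hf hf0 n _ (hM.secSub hf hf0 _)
      (mem_secSub.2 ⟨_, hfM, aut_b_smul_singleton _ _, sec_aut_b_last f⟩) ?_ hlen)
  obtain ⟨t, ht⟩ := exists_aut_a_pow_pow hk0
  have h7 := pow_mem (mem_secSub.2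
    ⟨_, mul_mem (mul_mem (inv_mem hyM) hfM) hyM, h5.1, h5.2⟩) t
  have h8 := conj_pow (i := t) (a := (sec y [lastLetter p])⁻¹) (b := aut_a p ^ (expo f k).val)
  rw [inv_inv] at h8
  rwa [h8, ht] at h7

/-- Descent on the length and the order of an element of a dense subgroup. -/
theorem spinal_le_of_len (htors : ∀ g ∈ spinal W, IsOfFinOrder g)
    (hcsp : CongruenceProperty W) (n o : ℕ) (M : Subgroup (treeAut p)) (hM : IsDense W M)
    {g : treeAut p} (hg : g ∈ M) {f : Fin (p - 1) → ZMod p} (hf0 : f ≠ 0) (hlen : Len W n f g)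
    (ho : orderOf g = o) : spinal W ≤ M := by
  induction n using Nat.strong_induction_on generalizing o M g f with
  | _ n ihn =>
  induction o using Nat.strong_induction_on generalizing M g f with
  | _ o iho =>
  have hf := hlen.mem.2
  obtain ⟨s, hs⟩ := hlen.exists_rot
  -- If `g` fixes the first level, a section with nonzero vector is shorter or is the letter `aut_b
  -- f`. Otherwise a section of `g ^ p` keeps length and vector but has smaller order.
  rcases eq_or_ne s 0 with rfl | hs0
  · have hfix (x : Fin p) : g • [x] = [x] := by rw [hs, add_zero]
    obtain ⟨ℓ, φ, h1, h2, h3, h4⟩ := hlen.sections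
    obtain ⟨x, hx⟩ : ∃ x, φ x ≠ 0 := by
      by_contra! h
      exact hf0 (h3 ▸ Finset.sum_eq_zero fun x _ => h x)
    refine spinal_le_of_secSub_singleton htors hcsp hf hf0 hM.1 hM.2 x ?_
    have hsx := sec_mem_secSub hg (hfix x)
    rcases eq_or_ne (ℓ x) n with hxn | hxn
    · obtain ⟨i, j, hij, hj⟩ := h4 x hxn
      refine spinal_le_of_aut_b_mem htors hcsp hf hf0 (hM.secSub hf hf0 [x]) ?_
      rwa [hij, sec_mul, sec_mul, hj, aut_b_smul_singleton, sec_aut_a_pow, sec_aut_a_pow,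
        sec_aut_b_last, one_mul, mul_one] at hsx
    · exact ihn _ (lt_of_le_of_ne
        (h2 ▸ Finset.single_le_sum (fun _ _ => Nat.zero_le _) (Finset.mem_univ x)) hxn) _ _
        (hM.secSub hf hf0 [x]) hsx hx (h1 x) rfl
  · choose ρ hρ using fun x : Fin p => exists_rot (sec_mem (hM.1 hg) [x])
    refine spinal_le_of_secSub_singleton htors hcsp hf hf0 hM.1 hM.2 0 ?_
    exact iho _ (ho ▸ (orderOf_sec_pow_lt (htors g (hM.1 hg)) hs hs0 0).2) _
      (hM.secSub hf hf0 [0]) (sec_mem_secSub (pow_mem hg p) (fix_pow_prime hs 0)) hf0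
      (hlen.sec_pow_prime hs hs0 hρ 0).1 rfl

theorem IsDense.spinal_le (htors : ∀ g ∈ spinal W, IsOfFinOrder g)
    (hcsp : CongruenceProperty W) {e : Fin (p - 1) → ZMod p} (heW : e ∈ W) (he : e ≠ 0)
    {M : Subgroup (treeAut p)} (hM : IsDense W M) : spinal W ≤ M := by
  obtain ⟨g, hg, n, hlen⟩ := hM.exists_len hcsp heW
  exact spinal_le_of_len htors hcsp n _ M hM hg he hlen rfl

/-- A subgroup of finite index in `spinal W` has no proper dense subgroup. -/
theorem le_of_approximates (htors : ∀ g ∈ spinal W, IsOfFinOrder g)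
    (hcsp : CongruenceProperty W) {e : Fin (p - 1) → ZMod p} (heW : e ∈ W) (he : e ≠ 0)
    {A D : Subgroup (treeAut p)} (hA : A ≤ spinal W) (hAi : A.relIndex (spinal W) ≠ 0)
    (hDA : D ≤ A) (happ : Approximates D A) : A ≤ D := by
  obtain ⟨m, hm⟩ := hcsp A hAi
  refine happ.le_of_relIndex_ne_zero hcsp hDA hA (relIndex_ne_zero_of_secSub htors hcsp heW he
    (n := m + 3) (hDA.trans hA) (happ.mono ((inf_le_inf_left _ (levelFix_anti (by omega))).trans hm))
    fun v hv => ?_)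
  refine IsDense.spinal_le htors hcsp heW he ⟨secSub_le (hDA.trans hA) v, ?_⟩
  exact ((happ.mono hm).secSub v).mono
    (spinal_le_secSub_levelFix heW he (sum_expo_eq_zero htors heW) m v hv)

end Prime

section Prime

variable [hpr : Fact p.Prime]

/-! ### Commensurable groups -/

theorem congruenceProperty_of_hasCongruenceSubgroupProperty
    {W : AddSubgroup (Fin (p - 1) → ZMod p)} (h : HasCongruenceSubgroupProperty (spinal W)) :
    CongruenceProperty W := fun F hF => by
  obtain ⟨n, hn⟩ := h (F.subgroupOf (spinal W)) ⟨hF⟩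
  exact ⟨n, fun g hg => @hn ⟨g, hg.1⟩ fun v hv => hg.2 v hv⟩

theorem finiteIndex_of_areCommensurable {W : AddSubgroup (Fin (p - 1) → ZMod p)}
    {w : Fin (p - 1) → ZMod p} (hwW : w ∈ W) (hw : w ≠ 0) (htors : IsMulTorsion (spinal W))
    (hcsp : HasCongruenceSubgroupProperty (spinal W)) (H : Type*) [Group H]
    (hH : AreCommensurable H (spinal W)) (M : Subgroup H) (hM : IsCoatom M) : M.FiniteIndex := by
  obtain ⟨A, B, hA, hB, ⟨e⟩⟩ := hH
  by_contra hMi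
  let j : A →* treeAut p := (spinal W).subtype.comp (B.subtype.comp e.toMonoidHom)
  have hj : Function.Injective j :=
    (spinal W).subtype_injective.comp (B.subtype_injective.comp e.injective)
  have hrange : j.range = B.map (spinal W).subtype := by
    ext x
    constructor
    · rintro ⟨y, rfl⟩
      exact ⟨(e y).1, (e y).2, rfl⟩
    · rintro ⟨y, hy, rfl⟩
      exact ⟨e.symm ⟨y, hy⟩, by simp [j]⟩
  have hindex : j.range.relIndex (spinal W) ≠ 0 := by
    rw [hrange, Subgroup.relIndex, Subgroup.subgroupOf,
      Subgroup.comap_map_eq_self_of_injective (spinal W).subtype_injective]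
    exact hB.index_ne_zero
  have happ : Approximates ((M.subgroupOf A).map j) j.range := by
    rintro _ ⟨x, rfl⟩ m
    have hF : (((levelFix p m).comap j).map A.subtype).FiniteIndex := ⟨by
      rw [Subgroup.index_map_subtype, Subgroup.index_comap]
      exact mul_ne_zero (relIndex_levelFix_ne_zero _ _) hA.index_ne_zero⟩
    set C := (((levelFix p m).comap j).map A.subtype).normalCore
    -- By maximality the alternative is `C ≤ M`, which would give `M` finite index.
    have hsup : M ⊔ C = ⊤ := by
      rcases hM.le_iff.1 (le_sup_left : M ≤ M ⊔ C) with h | h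
      · exact h
      · exact absurd (Subgroup.finiteIndex_of_le (sup_eq_left.1 h)) hMi
    have hx : (x : H) ∈ M ⊔ C := hsup ▸ Subgroup.mem_top _
    obtain ⟨y, hy, c, hc, hyc⟩ := Subgroup.mem_sup_of_normal_right.1 hx
    obtain ⟨c', hc', rfl⟩ := Subgroup.normalCore_le _ hc
    have hyA : y = ((x * c'⁻¹ : A) : H) := by
      rw [Subgroup.coe_mul, ← hyc, mul_assoc]
      simp
    refine ⟨j (x * c'⁻¹), ⟨_, ?_, rfl⟩, fun v hv => ?_⟩
    · change ((x * c'⁻¹ : A) : H) ∈ M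
      exact hyA ▸ hy
    · rw [map_mul, map_inv, mul_smul, inv_smul_of_fix (hc' v hv)]
  have hle : j.range ≤ spinal W := by
    rintro _ ⟨y, rfl⟩
    exact (e y).1.2
  have key := le_of_approximates
    (fun g hg => (Submonoid.isOfFinOrder_coe (H := (spinal W).toSubmonoid) (x := ⟨g, hg⟩)).2
      (htors ⟨g, hg⟩))
    (congruenceProperty_of_hasCongruenceSubgroupProperty hcsp) hwW hw hle hindex
    (Subgroup.map_le_range _ _) happ
  refine hMi (Subgroup.finiteIndex_of_le (H := A) fun x hx => ?_)
  obtain ⟨y, hy, hyx⟩ := key ⟨⟨x, hx⟩, rfl⟩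
  have : y = ⟨x, hx⟩ := hj hyx
  rw [this] at hy
  exact hy

end Prime

end SpinalGroup

theorem corollary1p2 (p : ℕ) [Fact p.Prime] (hp : p ≠ 2) (r : ℕ) (hr : 1 ≤ r)
    (E : Fin r → Fin (p - 1) → ZMod p) (hE : LinearIndependent (ZMod p) E)
    (htors : IsMulTorsion (SpinalGroup.multiEdgeSpinalGroup E))
    (hcsp : SpinalGroup.HasCongruenceSubgroupProperty (SpinalGroup.multiEdgeSpinalGroup E))
    (H : Type*) [Group H]
    (hH : SpinalGroup.AreCommensurable H (SpinalGroup.multiEdgeSpinalGroup E))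
    (M : Subgroup H) (hM : IsCoatom M) : M.FiniteIndex := by
  rw [SpinalGroup.multiEdgeSpinalGroup_eq] at htors hcsp hH
  exact SpinalGroup.finiteIndex_of_areCommensurable
    (AddSubgroup.subset_closure (Set.mem_range_self ⟨0, hr⟩)) (hE.ne_zero _) htors hcsp H hH M hM
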